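/- For $k\in\mathbb R$ let $L^1_k=L^1((1+x)^k)$ be the real Banach space of (classes of) measurable functions $h$ on $(0,\infty)$ with norm $\|h\|_k=\int_0^\infty |h(x)|(1+x)^k\,dx<\infty$. For $h\in C_c^\infty(0,\infty)$ put, with $G_0(x)=e^{-x}$, $$\mathcal L_0[h](x)=x\,h'(x)+2\int_0^x G_0(x-y)h(y)\,dy-2G_0(x)\int_0^\infty h(y)\,dy ,$$ the linearisation around $G_0$ of the self-similar Smoluchowski equation with constant kernel $K=2$. **Theorem.** Let $k>2$. The operator $\mathcal L_0$ with domain $C_c^\infty(0,\infty)$ is closable in $L^1_k$, and its closure, again denoted $\mathcal L_0$, generates a strongly continuous semigroup $(e^{t\mathcal L_0})_{t\ge 0}$ on $L^1_k$. This semigroup leaves the subspace $\{h\in L^1_k:\int_0^\infty x h(x)\,dx=0\}$ invariant, and there is a constant $C=C(k)>0$ such that $$\|e^{t\mathcal L_0}h\|_k\le C e^{-t/2}\|h\|_k\qquad\text{for all } t\ge 0 \text{ and all } h\in L^1_k \text{ with } \int_0^\infty x h(x)\,dx=0,$$ and, with the same constant $C$ and $M:=2C$, $$\|\mathcal L_0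 h\|_k\ge \frac1M\|h\|_k\qquad\text{for all } h \text{ in the domain of } \mathcal L_0 \text{ with } \int_0^\infty x h(x)\,dx=0 .$$ -/

import Mathlib

open MeasureTheory Set Filter Topology
open scoped NNReal

namespace Coagulation

noncomputable section

/-! ### The weighted space `L¹((1+x)^k)` on `(0,∞)` -/

/-- The measure `(1+x)^k dx` on `(0,∞)`. -/
def weightMeasure (k : ℝ) : Measure ℝ :=
  (volume.restrict (Ioi (0 : ℝ))).withDensity fun x => ENNReal.ofReal ((1 + x) ^ k)

/-- The real Banach space `L¹((1+x)^k)`, with norm `‖h‖ = ∫₀^∞ |h(x)| (1+x)^k dx`. -/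
abbrev L1w (k : ℝ) : Type := Lp ℝ 1 (weightMeasure k)

/-- The first moment `∫₀^∞ x h(x) dx`. -/
def firstMoment (h : ℝ → ℝ) : ℝ := ∫ x in Ioi (0 : ℝ), x * h x

/-! ### The linearised operator on smooth compactly supported functions -/

/-- The profile `G₀(x) = e^{-x}`. -/
def profile (x : ℝ) : ℝ := Real.exp (-x)

/-- The convolution on the half-line, `(f ∗ g)(x) = ∫₀^x f(x-y) g(y) dy`. -/
def halfConv (f g : ℝ → ℝ) (x : ℝ) : ℝ := ∫ y in (0 : ℝ)..x, f (x - y) * g y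

/-- The linearised self-similar coagulation operator for the kernel `K = 2` around `G₀`,
`x h'(x) + 2 (G₀ ∗ h)(x) - 2 G₀(x) ∫₀^∞ h(y) dy`. -/
def linExpr (h : ℝ → ℝ) (x : ℝ) : ℝ :=
  x * deriv h x + 2 * halfConv profile h x - 2 * profile x * ∫ y in Ioi (0 : ℝ), h y

/-- The space `C_c^∞(0,∞)` (extended by zero to the real line). -/
abbrev TestFn : Type := TestFunction (⟨Ioi 0, isOpen_Ioi⟩ : TopologicalSpace.Opens ℝ) ℝ ⊤

theorem memLp_weight (k : ℝ) {f : ℝ → ℝ} (hf : Continuous f) {c R : ℝ}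
    (hR : ∀ x, R ≤ x → f x = c * Real.exp (-x)) : MemLp f 1 (weightMeasure k) := by
  have hm : Measurable fun x : ℝ => ENNReal.ofReal ((1 + x) ^ k) := by fun_prop
  rw [memLp_one_iff_integrable, weightMeasure,
    integrable_withDensity_iff hm (by simp)]
  have key : IntegrableOn (fun x => f x * (1 + x) ^ k) (Ioi 0) := by
    refine integrable_of_isBigO_exp_neg (b := 1 / 2) (by norm_num) ?_ ?_
    · refine hf.continuousOn.mul (ContinuousOn.rpow_const (by fun_prop) ?_)
      intro x hx
      left
      have : (0 : ℝ) ≤ x := hx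
      positivity
    · have h1 : (fun x : ℝ => (1 + x) ^ k) =o[atTop] fun x => Real.exp (1 / 2 * (1 + x)) :=
        (isLittleO_rpow_exp_pos_mul_atTop k (by norm_num : (0 : ℝ) < 1 / 2)).comp_tendsto
          (tendsto_atTop_add_const_left _ _ tendsto_id)
      have h2 : (fun x => f x) =O[atTop] fun x => Real.exp (-x) := by
        refine Asymptotics.IsBigO.of_bound |c| ?_
        filter_upwards [eventually_ge_atTop R] with x hx
        rw [hR x hx, norm_mul, Real.norm_eq_abs c]
      refine (h2.mul h1.isBigO).trans ?_
      refine Asymptotics.IsBigO.of_bound (Real.exp (1 / 2)) (Eventually.of_forall fun x => ?_)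
      rw [← Real.exp_add, Real.norm_eq_abs, Real.norm_eq_abs, Real.abs_exp, Real.abs_exp,
        ← Real.exp_add]
      apply le_of_eq
      congr 1
      ring
  refine (integrable_congr ?_).mp key
  filter_upwards [ae_restrict_mem measurableSet_Ioi] with x hx
  rw [ENNReal.toReal_ofReal]
  have : (0 : ℝ) < x := hx
  positivity

theorem TestFn.exists_bound (φ : TestFn) : ∃ R : ℝ, 0 < R ∧ ∀ x, R ≤ x → φ x = 0 := by
  obtain ⟨r, hr⟩ := φ.hasCompactSupport.isCompact.isBounded.subset_closedBall 0
  refine ⟨max r 0 + 1, by positivity, fun x hx => ?_⟩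
  by_contra h
  have h1 := hr (subset_tsupport _ h)
  rw [mem_closedBall_zero_iff, Real.norm_eq_abs] at h1
  have := le_abs_self x
  have := le_max_left r 0
  linarith

theorem TestFn.contDiff_infty (φ : TestFn) : ContDiff ℝ ((⊤ : ℕ∞) : WithTop ℕ∞) φ := φ.contDiff

theorem halfConv_profile {h : ℝ → ℝ} (x : ℝ) :
    halfConv profile h x = Real.exp (-x) * ∫ y in (0 : ℝ)..x, Real.exp y * h y := by
  rw [halfConv, ← intervalIntegral.integral_const_mul]
  refine intervalIntegral.integral_congr fun y _ => ?_
  simp only [profile]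
  rw [← mul_assoc, ← Real.exp_add]
  congr 2
  ring

theorem TestFn.continuous_linExpr (φ : TestFn) : Continuous (linExpr φ) := by
  have h1 : Continuous (deriv φ) := φ.contDiff_infty.continuous_deriv (by simp)
  have h2 : Continuous fun x => ∫ y in (0 : ℝ)..x, Real.exp y * φ y :=
    intervalIntegral.continuous_primitive
      (fun a b => (Real.continuous_exp.mul φ.continuous).intervalIntegrable a b) 0
  unfold linExpr
  simp only [halfConv_profile, profile]
  fun_prop

theorem TestFn.memLp (k : ℝ) (φ : TestFn) : MemLp φ 1 (weightMeasure k) := by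
  obtain ⟨R, -, hR⟩ := φ.exists_bound
  exact memLp_weight k φ.continuous (c := 0) (R := R) fun x hx => by rw [hR x hx, zero_mul]

theorem TestFn.memLp_linExpr (k : ℝ) (φ : TestFn) : MemLp (linExpr φ) 1 (weightMeasure k) := by
  obtain ⟨R, hR0, hR⟩ := φ.exists_bound
  refine memLp_weight k φ.continuous_linExpr (R := R + 1)
    (c := 2 * (∫ y in (0 : ℝ)..R, Real.exp y * φ y) - 2 * ∫ y in Ioi (0 : ℝ), φ y)
    fun x hx => ?_
  have hd : deriv φ x = 0 := by
    have : (φ : ℝ → ℝ) =ᶠ[𝓝 x] fun _ => 0 := by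
      filter_upwards [Ioi_mem_nhds (show R < x by linarith)] with y hy
      exact hR y (le_of_lt hy)
    rw [this.deriv_eq, deriv_const]
  have hc : Continuous fun y => Real.exp y * φ y := Real.continuous_exp.mul φ.continuous
  have hi : (∫ y in (0 : ℝ)..x, Real.exp y * φ y) = ∫ y in (0 : ℝ)..R, Real.exp y * φ y := by
    rw [← intervalIntegral.integral_add_adjacent_intervals (hc.intervalIntegrable 0 R)
      (hc.intervalIntegrable R x), add_eq_left]
    rw [intervalIntegral.integral_congr (g := fun _ => (0 : ℝ)), intervalIntegral.integral_zero]
    intro y hy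
    rw [uIcc_of_le (by linarith)] at hy
    simp only [hR y hy.1, mul_zero]
  rw [linExpr, hd, halfConv_profile, hi, profile]
  ring

theorem TestFn.integrable (φ : TestFn) : Integrable φ :=
  φ.continuous.integrable_of_hasCompactSupport φ.hasCompactSupport

theorem linExpr_add (φ ψ : TestFn) : linExpr (φ + ψ : TestFn) = linExpr φ + linExpr ψ := by
  ext x
  have e : ((φ + ψ : TestFn) : ℝ → ℝ) = fun y => φ y + ψ y := rfl
  have h1 : deriv (fun y => φ y + ψ y) x = deriv φ x + deriv ψ x :=
    deriv_add (φ.contDiff_infty.differentiable (by simp) x)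
      (ψ.contDiff_infty.differentiable (by simp) x)
  have h2 : (∫ y in Ioi (0 : ℝ), (φ y + ψ y)) =
      (∫ y in Ioi (0 : ℝ), φ y) + ∫ y in Ioi (0 : ℝ), ψ y :=
    integral_add φ.integrable.integrableOn ψ.integrable.integrableOn
  have h3 : (∫ y in (0 : ℝ)..x, Real.exp y * (φ y + ψ y)) =
      (∫ y in (0 : ℝ)..x, Real.exp y * φ y) + ∫ y in (0 : ℝ)..x, Real.exp y * ψ y := by
    have i1 : Continuous fun y => Real.exp y * φ y := Real.continuous_exp.mul φ.continuous
    have i2 : Continuous fun y => Real.exp y * ψ y := Real.continuous_exp.mul ψ.continuous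
    rw [← intervalIntegral.integral_add (i1.intervalIntegrable _ _) (i2.intervalIntegrable _ _)]
    simp only [mul_add]
  simp only [Pi.add_apply, linExpr, halfConv_profile, e, h1, h2, h3]
  ring

theorem linExpr_smul (c : ℝ) (φ : TestFn) : linExpr (c • φ : TestFn) = c • linExpr φ := by
  ext x
  have e : ((c • φ : TestFn) : ℝ → ℝ) = fun y => c * φ y := rfl
  have h1 : deriv (fun y => c * φ y) x = c * deriv φ x :=
    deriv_const_mul c (φ.contDiff_infty.differentiable (by simp) x)
  have h2 : (∫ y in Ioi (0 : ℝ), c * φ y) = c * ∫ y in Ioi (0 : ℝ), φ y :=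
    integral_const_mul c _
  have h3 : (∫ y in (0 : ℝ)..x, Real.exp y * (c * φ y)) =
      c * ∫ y in (0 : ℝ)..x, Real.exp y * φ y := by
    rw [← intervalIntegral.integral_const_mul]
    congr 1
    ext y
    ring
  simp only [Pi.smul_apply, smul_eq_mul, linExpr, halfConv_profile, e, h1, h2, h3]
  ring

/-- The inclusion of `C_c^∞(0,∞)` into `L¹((1+x)^k)`. -/
def testIncl (k : ℝ) : TestFn →ₗ[ℝ] L1w k where
  toFun φ := (φ.memLp k).toLp φ
  map_add' φ ψ := MemLp.toLp_add (φ.memLp k) (ψ.memLp k)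
  map_smul' c φ := MemLp.toLp_const_smul c (φ.memLp k)

/-- The linearised operator as a linear map from `C_c^∞(0,∞)` to `L¹((1+x)^k)`. -/
def linTest (k : ℝ) : TestFn →ₗ[ℝ] L1w k where
  toFun φ := (φ.memLp_linExpr k).toLp (linExpr φ)
  map_add' φ ψ := by
    rw [← MemLp.toLp_add (φ.memLp_linExpr k) (ψ.memLp_linExpr k)]
    exact MemLp.toLp_congr _ _ (by rw [linExpr_add])
  map_smul' c φ := by
    rw [RingHom.id_apply, ← MemLp.toLp_const_smul c (φ.memLp_linExpr k)]
    exact MemLp.toLp_congr _ _ (by rw [linExpr_smul])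

theorem testIncl_injective (k : ℝ) : Function.Injective (testIncl k) := by
  intro φ ψ h
  have h1 : φ =ᵐ[weightMeasure k] ψ :=
    (MemLp.toLp_eq_toLp_iff (φ.memLp k) (ψ.memLp k)).mp h
  have hm : Measurable fun x : ℝ => ENNReal.ofReal ((1 + x) ^ k) := by fun_prop
  have h2 : φ =ᵐ[volume.restrict (Ioi (0 : ℝ))] ψ := by
    have h3 := (ae_withDensity_iff hm).mp h1
    filter_upwards [h3, ae_restrict_mem measurableSet_Ioi] with x hx hx0
    apply hx
    have : (0 : ℝ) < x := hx0
    simp only [ne_eq, ENNReal.ofReal_eq_zero, not_le]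
    positivity
  have h4 : EqOn φ ψ (Ioi 0) :=
    Measure.eqOn_open_of_ae_eq h2 isOpen_Ioi φ.continuous.continuousOn ψ.continuous.continuousOn
  refine TestFunction.ext fun x => ?_
  by_cases hx : x ∈ Ioi (0 : ℝ)
  · exact h4 hx
  · rw [image_eq_zero_of_notMem_tsupport fun hh => hx (φ.tsupport_subset hh),
      image_eq_zero_of_notMem_tsupport fun hh => hx (ψ.tsupport_subset hh)]

/-- The linearised operator as an unbounded operator in `L¹((1+x)^k)` with domain
`C_c^∞(0,∞)`. -/
def L0core (k : ℝ) : L1w k →ₗ.[ℝ] L1w k where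
  domain := LinearMap.range (testIncl k)
  toFun := linTest k ∘ₗ (LinearEquiv.ofInjective (testIncl k) (testIncl_injective k)).symm

/-- The operator `𝓛₀` in `L¹((1+x)^k)`: the closure of the linearised operator on
`C_c^∞(0,∞)`. -/
def L0 (k : ℝ) : L1w k →ₗ.[ℝ] L1w k := (L0core k).closure

/-! ### Strongly continuous semigroups -/

/-- A strongly continuous semigroup of bounded operators on a normed space. -/
structure C0Semigroup (E : Type*) [NormedAddCommGroup E] [NormedSpace ℝ E] where
  /-- The operator at time `t ≥ 0`. -/
  op : ℝ≥0 → E →L[ℝ] E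
  op_zero : op 0 = ContinuousLinearMap.id ℝ E
  op_add : ∀ s t, op (s + t) = (op s).comp (op t)
  continuous_orbit : ∀ u, Continuous fun t => op t u

/-- `A` is the (infinitesimal) generator of `T`: `u` is in the domain of `A` and `A u = v` exactly
when `(T_t u - u) / t → v` as `t → 0⁺`. -/
def IsGenerator {E : Type*} [NormedAddCommGroup E] [NormedSpace ℝ E]
    (A : E →ₗ.[ℝ] E) (T : C0Semigroup E) : Prop :=
  ∀ u v : E, (u, v) ∈ A.graph ↔
    Tendsto (fun t : ℝ≥0 => (t : ℝ)⁻¹ • (T.op t u - u)) (𝓝[>] 0) (𝓝 v)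

end

end Coagulation

namespace Coagulation

/-! ### Basic facts on the weighted measure -/

/-! For the constant kernel the semigroup is explicit. Write `A h = G₀ ∗ h - G₀ ∫ h` (`convOp`) and
`D_t h = h(e^t ·)` (`dilation`), so that the operator is `x d/dx + 2A`, a bounded perturbation of
the generator of `D`. The function `y = A h` solves `y' + y = h`, `y(0) = -∫ h`, and this initial
value is the one for which `∫ y = 0`. Scaling this equation yields `A D_t = e^{-t} D_t A + (1 -
e^{-t}) A D_t A` (`convOp_dilation`), and with `R_t = 1 + (e^t - 1) A` (`smoothing`) it follows that
`S_t = R_t² D_t` (`coagSemigroup`) is a semigroup.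

Generator. In operator norm `R_t² = 1 + 2tA + o(t)`, so the generator of `S` is that of `D` plus
`2A` (`gen_iff_of_factor`). Test functions are a core for the generator of `D`, because it is
bounded below and the functions `x φ'` are dense (`gen_dilation_iff`). Adding `2A` shears one graph
onto the other, hence the closed graph of the core operator is the graph of the generator of `S`;
being single-valued, it gives closability as well.

Decay. Expanding, `S_t = D_t + 2(e^t - 1) A D_t + (e^t - 1)² A² D_t`. The three terms are
`O(e^{-t})` provided that `D_t`, `A D_t`, `A² D_t` decay like `e^{-t}`, `e^{-2t}`, `e^{-3t}`. Each
extra factor comes from an order of vanishing at `z = 0` of the kernel columns: the column `G₀(x-z)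
- G₀(x)` of `A` has norm `O(z)` near `0`. With `Q(x) = x e^{-x}`, the column `Q(x-z) - Q(x)` of `A²`
becomes `O(z²)` once `z Q'(x)` is added, and this correction integrates to the first moment times
`Q'`, which is zero on the invariant subspace. The rate obtained is `e^{-t}`, stronger than
required.

Lower bound. Integrating the orbit gives `u = S_t u - ∫₀^t S_s v ds` for `v` the image of `u`; the
moment of `v` is zero because `S` conserves the moment, and `t → ∞` concludes
(`C0Semigroup.Gen.norm_le`). -/

theorem measurable_weight (k : ℝ) : Measurable fun x : ℝ => ENNReal.ofReal ((1 + x) ^ k) := by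
  fun_prop

theorem integrable_weight_iff {k : ℝ} {f : ℝ → ℝ} :
    Integrable f (weightMeasure k) ↔ IntegrableOn (fun x => f x * (1 + x) ^ k) (Ioi 0) := by
  rw [weightMeasure, integrable_withDensity_iff (measurable_weight k) (by simp)]
  refine integrable_congr ?_
  filter_upwards [ae_restrict_mem measurableSet_Ioi] with x hx
  rw [ENNReal.toReal_ofReal]
  have : (0 : ℝ) < x := hx
  positivity

theorem integral_weight (k : ℝ) (f : ℝ → ℝ) :
    ∫ x, f x ∂(weightMeasure k) = ∫ x in Ioi (0 : ℝ), f x * (1 + x) ^ k := by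
  rw [weightMeasure, integral_withDensity_eq_integral_toReal_smul (measurable_weight k) (by simp)]
  refine integral_congr_ae ?_
  filter_upwards [ae_restrict_mem measurableSet_Ioi] with x hx
  rw [ENNReal.toReal_ofReal, smul_eq_mul, mul_comm]
  have : (0 : ℝ) < x := hx
  positivity

theorem lintegral_weight (k : ℝ) {f : ℝ → ENNReal}
    (hf : AEMeasurable f (volume.restrict (Ioi (0 : ℝ)))) :
    ∫⁻ x, f x ∂(weightMeasure k) =
      ∫⁻ x in Ioi (0 : ℝ), ENNReal.ofReal ((1 + x) ^ k) * f x := by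
  rw [weightMeasure, lintegral_withDensity_eq_lintegral_mul₀ (measurable_weight k).aemeasurable hf]
  rfl

theorem ae_weight_iff {k : ℝ} {p : ℝ → Prop} :
    (∀ᵐ x ∂(weightMeasure k), p x) ↔ ∀ᵐ x ∂(volume.restrict (Ioi (0 : ℝ))), p x := by
  rw [weightMeasure, ae_withDensity_iff (measurable_weight k)]
  constructor
  · intro h
    filter_upwards [h, ae_restrict_mem measurableSet_Ioi] with x hx hx0
    apply hx
    have : (0 : ℝ) < x := hx0
    simp only [ne_eq, ENNReal.ofReal_eq_zero, not_le]
    positivity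
  · intro h
    filter_upwards [h] with x hx _ using hx

instance (k : ℝ) : IsLocallyFiniteMeasure (weightMeasure k) := by
  -- With `|x|` in place of `x` the density is continuous on the whole line, also left of `-1`.
  have : weightMeasure k =
      (volume.restrict (Ioi (0 : ℝ))).withDensity fun x => ENNReal.ofReal ((1 + |x|) ^ k) := by
    refine withDensity_congr_ae ?_
    filter_upwards [ae_restrict_mem measurableSet_Ioi] with x hx
    rw [abs_of_pos hx]
  rw [this]
  refine IsLocallyFiniteMeasure.withDensity_ofReal ?_
  refine Continuous.rpow_const (by fun_prop) fun x => Or.inl ?_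
  positivity

instance (k : ℝ) : SFinite (weightMeasure k) := by
  unfold weightMeasure; infer_instance

theorem one_le_weight {k x : ℝ} (hk : 0 ≤ k) (hx : 0 ≤ x) : 1 ≤ (1 + x) ^ k :=
  Real.one_le_rpow (by linarith) hk

theorem le_weight {k x : ℝ} (hk : 1 ≤ k) (hx : 0 ≤ x) : x ≤ (1 + x) ^ k := by
  calc x ≤ (1 + x) ^ (1 : ℝ) := by rw [Real.rpow_one]; linarith
    _ ≤ _ := Real.rpow_le_rpow_of_exponent_le (by linarith) hk

theorem aestronglyMeasurable_weight_iff {k : ℝ} {f : ℝ → ℝ} :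
    AEStronglyMeasurable f (weightMeasure k) ↔
      AEStronglyMeasurable f (volume.restrict (Ioi (0 : ℝ))) :=
  ⟨fun h => ⟨h.mk f, h.stronglyMeasurable_mk, ae_weight_iff.1 h.ae_eq_mk⟩,
    fun h => ⟨h.mk f, h.stronglyMeasurable_mk, ae_weight_iff.2 h.ae_eq_mk⟩⟩

theorem integrableOn_mul_of_weight {k : ℝ} {f g : ℝ → ℝ} (hf : Integrable f (weightMeasure k))
    (hg : AEStronglyMeasurable g (volume.restrict (Ioi (0 : ℝ))))
    (hgk : ∀ x, 0 < x → |g x| ≤ (1 + x) ^ k) : IntegrableOn (fun x => g x * f x) (Ioi 0) := by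
  refine Integrable.mono (integrable_weight_iff.1 hf)
    (hg.mul (aestronglyMeasurable_weight_iff.1 hf.aestronglyMeasurable)) ?_
  filter_upwards [ae_restrict_mem measurableSet_Ioi] with x hx
  have h0 : (0 : ℝ) < x := hx
  have h1 : 0 ≤ (1 + x) ^ k := by positivity
  rw [norm_mul, norm_mul, mul_comm, Real.norm_eq_abs (_ ^ _), abs_of_nonneg h1]
  exact mul_le_mul_of_nonneg_left (hgk x h0) (norm_nonneg _)

theorem integrableOn_of_weight {k : ℝ} (hk : 0 ≤ k) {f : ℝ → ℝ}
    (hf : Integrable f (weightMeasure k)) : IntegrableOn f (Ioi 0) := by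
  simpa using integrableOn_mul_of_weight (g := fun _ => 1) hf (by fun_prop)
    fun x hx => by simpa using one_le_weight hk hx.le

theorem integrableOn_id_mul_of_weight {k : ℝ} (hk : 1 ≤ k) {f : ℝ → ℝ}
    (hf : Integrable f (weightMeasure k)) : IntegrableOn (fun x => x * f x) (Ioi 0) :=
  integrableOn_mul_of_weight (g := fun x => x) hf (by fun_prop)
    fun x hx => by rw [abs_of_pos hx]; exact le_weight hk hx.le

theorem integrable_coe {k : ℝ} (h : L1w k) : Integrable h (weightMeasure k) :=
  L1.integrable_coeFn h

theorem norm_eq_integral_weight {k : ℝ} (h : L1w k) :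
    ‖h‖ = ∫ x in Ioi (0 : ℝ), |h x| * (1 + x) ^ k := by
  rw [L1.norm_eq_integral_norm, integral_weight]
  rfl

theorem norm_toL1_weight {k : ℝ} {f : ℝ → ℝ} (hf : Integrable f (weightMeasure k)) :
    ‖hf.toL1 f‖ = ∫ x in Ioi (0 : ℝ), |f x| * (1 + x) ^ k := by
  rw [L1.norm_of_fun_eq_integral_norm, integral_weight]
  rfl

theorem coeFn_toL1_weight {k : ℝ} {f : ℝ → ℝ} (hf : Integrable f (weightMeasure k)) :
    (hf.toL1 f : ℝ → ℝ) =ᵐ[volume.restrict (Ioi (0 : ℝ))] f :=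
  ae_weight_iff.1 hf.coeFn_toL1

theorem toL1_eq_iff_weight {k : ℝ} {f : ℝ → ℝ} (hf : Integrable f (weightMeasure k)) (h : L1w k) :
    hf.toL1 f = h ↔ f =ᵐ[volume.restrict (Ioi (0 : ℝ))] h := by
  rw [Lp.ext_iff]
  constructor
  · intro hh
    exact ae_weight_iff.1 (hf.coeFn_toL1.symm.trans hh : f =ᵐ[weightMeasure k] h)
  · intro hh
    exact hf.coeFn_toL1.trans (ae_weight_iff.2 hh)

theorem tendsto_toL1_of_dominated {ι : Type*} {l : Filter ι} [l.IsCountablyGenerated] {k : ℝ}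
    {F : ι → ℝ → ℝ} {f g : ℝ → ℝ} (hF : ∀ i, Integrable (F i) (weightMeasure k))
    (hf : Integrable f (weightMeasure k)) (hg : Integrable g (weightMeasure k))
    (hb : ∀ᶠ i in l, ∀ x, 0 < x → |F i x| ≤ g x)
    (hlim : ∀ x, 0 < x → Tendsto (fun i => F i x) l (𝓝 (f x))) :
    Tendsto (fun i => (hF i).toL1 (F i)) l (𝓝 (hf.toL1 f)) := by
  rw [tendsto_iff_norm_sub_tendsto_zero]
  have : ∀ i, ‖(hF i).toL1 (F i) - hf.toL1 f‖ = ∫ x, ‖F i x - f x‖ ∂(weightMeasure k) := by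
    intro i
    rw [← Integrable.toL1_sub _ _ (hF i) hf, L1.norm_of_fun_eq_integral_norm]
    rfl
  simp_rw [this]
  have h0 : (0 : ℝ) = ∫ x, (fun _ => (0 : ℝ)) x ∂(weightMeasure k) := by simp
  rw [h0]
  refine tendsto_integral_filter_of_dominated_convergence (fun x => g x + ‖f x‖) ?_ ?_
    (hg.add hf.norm) ?_
  · exact Eventually.of_forall fun i => ((hF i).sub hf).norm.aestronglyMeasurable
  · filter_upwards [hb] with i hi
    refine ae_weight_iff.2 ?_
    filter_upwards [ae_restrict_mem measurableSet_Ioi] with x hx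
    rw [norm_norm]
    refine (norm_sub_le _ _).trans ?_
    gcongr
    exact hi x hx
  · refine ae_weight_iff.2 ?_
    filter_upwards [ae_restrict_mem measurableSet_Ioi] with x hx
    have := ((hlim x hx).sub_const (f x)).norm
    simpa using this

/-! ### Test functions -/

theorem TestFn.integrable_weight (k : ℝ) (φ : TestFn) : Integrable φ (weightMeasure k) :=
  memLp_one_iff_integrable.1 (φ.memLp k)

theorem testIncl_apply (k : ℝ) (φ : TestFn) : testIncl k φ = (φ.integrable_weight k).toL1 φ := rfl

theorem TestFn.exists_pos_bound (φ : TestFn) : ∃ r : ℝ, 0 < r ∧ ∀ x, x < r → φ x = 0 := by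
  by_cases hne : (tsupport φ).Nonempty
  · obtain ⟨r, hr, hmin⟩ := φ.hasCompactSupport.isCompact.exists_isLeast hne
    exact ⟨r, φ.tsupport_subset hr, fun x hx =>
      image_eq_zero_of_notMem_tsupport fun hh => not_le.2 hx (hmin hh)⟩
  · exact ⟨1, one_pos, fun x _ => image_eq_zero_of_notMem_tsupport fun hh => hne ⟨x, hh⟩⟩

/-- A smooth function vanishing outside a compact subinterval of `(0,∞)` is a test function. -/
def TestFn.mkOfBounds (f : ℝ → ℝ) (hf : ContDiff ℝ ((⊤ : ℕ∞) : WithTop ℕ∞) f)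
    (h : ∃ r R : ℝ, 0 < r ∧ ∀ x, x ∉ Icc r R → f x = 0) : TestFn where
  toFun := f
  contDiff' := hf
  hasCompactSupport' := by
    obtain ⟨r, R, -, h⟩ := h
    exact HasCompactSupport.intro isCompact_Icc h
  tsupport_subset' := by
    obtain ⟨r, R, hr, h⟩ := h
    refine (closure_minimal (fun x hx => ?_) isClosed_Icc : tsupport f ⊆ Icc r R).trans
      fun x hx => lt_of_lt_of_le hr hx.1
    by_contra hh
    exact hx (h x hh)

@[simp] theorem TestFn.coe_mkOfBounds (f : ℝ → ℝ) (hf : ContDiff ℝ ((⊤ : ℕ∞) : WithTop ℕ∞) f)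
    (h : ∃ r R : ℝ, 0 < r ∧ ∀ x, x ∉ Icc r R → f x = 0) :
    (TestFn.mkOfBounds f hf h : ℝ → ℝ) = f := rfl

theorem TestFn.exists_bounds (φ : TestFn) :
    ∃ r R : ℝ, 0 < r ∧ ∀ x, x ∉ Icc r R → φ x = 0 := by
  obtain ⟨r, hr, h1⟩ := φ.exists_pos_bound
  obtain ⟨R, -, h2⟩ := φ.exists_bound
  refine ⟨r, R, hr, fun x hx => ?_⟩
  rw [mem_Icc, not_and_or, not_le, not_le] at hx
  exact hx.elim (h1 x) fun h => h2 x h.le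

theorem dense_range_testIncl (k : ℝ) : DenseRange (testIncl k) := by
  have h1 := MeasureTheory.Lp.dense_hasCompactSupport_contDiff (F := ℝ) (μ := weightMeasure k)
    (p := 1) (by simp)
  refine dense_iff_closure_eq.2 (eq_univ_of_univ_subset ?_)
  rw [← h1.closure_eq]
  refine closure_minimal ?_ isClosed_closure
  rintro f ⟨g, hfg, hg, hgs⟩
  obtain ⟨R, hR⟩ : ∃ R : ℝ, ∀ x, R < x → g x = 0 := by
    obtain ⟨r, hr⟩ := hg.isCompact.isBounded.subset_closedBall 0
    refine ⟨r, fun x hx => image_eq_zero_of_notMem_tsupport fun hh => ?_⟩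
    have := hr hh
    rw [mem_closedBall_zero_iff, Real.norm_eq_abs] at this
    linarith [le_abs_self x]
  have hgi : Integrable g (weightMeasure k) := hgs.continuous.integrable_of_hasCompactSupport hg
  -- The approximant `g` is compactly supported in `ℝ` and may reach the origin. The cutoff vanishes
  -- for `n x ≤ 1` and equals `1` for `n x ≥ 2`.
  set F : ℕ → ℝ → ℝ := fun n x => Real.smoothTransition ((n : ℝ) * x - 1) * g x with hFdef
  have hFs : ∀ n, ContDiff ℝ ((⊤ : ℕ∞) : WithTop ℕ∞) (F n) := fun n =>
    (Real.smoothTransition.contDiff.comp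
      ((contDiff_const.mul contDiff_id).sub contDiff_const)).mul hgs
  have hFb : ∀ n, ∃ r R : ℝ, 0 < r ∧ ∀ x, x ∉ Icc r R → F n x = 0 := by
    intro n
    -- The denominator `n + 1` also covers `n = 0`, where the cutoff is identically zero.
    refine ⟨1 / ((n : ℝ) + 1), R, by positivity, fun x hx => ?_⟩
    rw [mem_Icc, not_and_or, not_le, not_le] at hx
    rcases hx with hx | hx
    · rw [hFdef]
      simp only
      rw [Real.smoothTransition.zero_of_nonpos, zero_mul]
      rw [lt_div_iff₀ (by positivity)] at hx
      have hn : (0 : ℝ) ≤ n := by positivity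
      rcases le_total 0 x with h0 | h0
      · nlinarith
      · nlinarith
    · simp [hFdef, hR x hx]
  have hlim := tendsto_toL1_of_dominated (l := atTop) (k := k) (F := F) (f := g)
    (g := fun x => ‖g x‖) (fun n => (TestFn.mkOfBounds (F n) (hFs n) (hFb n)).integrable_weight k)
    hgi hgi.norm
    (Eventually.of_forall fun n x _ => by
      rw [hFdef]
      simp only
      rw [abs_mul, abs_of_nonneg (Real.smoothTransition.nonneg _), Real.norm_eq_abs]
      exact mul_le_of_le_one_left (abs_nonneg _) (Real.smoothTransition.le_one _))
    (fun x hx => by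
      refine tendsto_const_nhds.congr' ?_
      filter_upwards [tendsto_natCast_atTop_atTop.eventually_ge_atTop (2 / x)] with n hn
      rw [hFdef]
      simp only
      rw [Real.smoothTransition.one_of_one_le, one_mul]
      rw [div_le_iff₀ hx] at hn
      linarith)
  have hfe : hgi.toL1 g = f := by
    rw [Lp.ext_iff]
    exact hgi.coeFn_toL1.trans hfg.symm
  rw [hfe] at hlim
  exact mem_closure_of_tendsto hlim (Eventually.of_forall fun n =>
    ⟨TestFn.mkOfBounds (F n) (hFs n) (hFb n), rfl⟩)

end Coagulation

namespace Coagulation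

/-! ### Strongly continuous semigroups -/

section Semigroup

variable {E : Type*} [NormedAddCommGroup E] [NormedSpace ℝ E]

/-- `u` is in the domain of the generator of `T`, with image `v`. -/
def C0Semigroup.Gen (T : C0Semigroup E) (u v : E) : Prop :=
  Tendsto (fun t : ℝ≥0 => (t : ℝ)⁻¹ • (T.op t u - u)) (𝓝[>] 0) (𝓝 v)

theorem tendsto_toNNReal_nhdsGT_zero : Tendsto Real.toNNReal (𝓝[>] 0) (𝓝[>] 0) := by
  refine tendsto_nhdsWithin_iff.2 ⟨?_, ?_⟩
  · have := continuous_real_toNNReal.tendsto (0 : ℝ)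
    rw [Real.toNNReal_zero] at this
    exact this.mono_left nhdsWithin_le_nhds
  · filter_upwards [self_mem_nhdsWithin] with x hx
    exact Real.toNNReal_pos.2 hx

theorem tendsto_coe_nhdsGT_zero : Tendsto ((↑) : ℝ≥0 → ℝ) (𝓝[>] 0) (𝓝[>] 0) := by
  refine tendsto_nhdsWithin_iff.2 ⟨?_, ?_⟩
  · exact (NNReal.continuous_coe.tendsto 0).mono_left nhdsWithin_le_nhds
  · filter_upwards [self_mem_nhdsWithin] with x hx
    exact NNReal.coe_pos.2 hx

theorem C0Semigroup.gen_iff_real (T : C0Semigroup E) (u v : E) :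
    T.Gen u v ↔
      Tendsto (fun h : ℝ => h⁻¹ • (T.op h.toNNReal u - u)) (𝓝[>] 0) (𝓝 v) := by
  constructor
  · intro h
    refine (h.comp tendsto_toNNReal_nhdsGT_zero).congr' ?_
    filter_upwards [self_mem_nhdsWithin] with x hx
    simp [Real.coe_toNNReal x (le_of_lt hx)]
  · intro h
    refine (h.comp tendsto_coe_nhdsGT_zero).congr fun x => ?_
    simp

theorem C0Semigroup.Gen.unique {T : C0Semigroup E} {u v w : E} (h : T.Gen u v) (h' : T.Gen u w) :
    v = w := tendsto_nhds_unique h h'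

theorem C0Semigroup.Gen.sub {T : C0Semigroup E} {u v u' v' : E} (h : T.Gen u v)
    (h' : T.Gen u' v') : T.Gen (u - u') (v - v') := by
  refine (Tendsto.sub h h').congr fun t => ?_
  rw [← smul_sub, map_sub]
  congr 1
  abel

theorem C0Semigroup.continuous_orbit_real (T : C0Semigroup E) (u : E) :
    Continuous fun s : ℝ => T.op s.toNNReal u :=
  (T.continuous_orbit u).comp continuous_real_toNNReal

/-- The semigroup law moves the limit at `0` to time `s`, from the right only. Together with
continuity of the orbit this suffices for the fundamental theorem of calculus. -/
theorem C0Semigroup.Gen.hasDerivWithinAt {T : C0Semigroup E} {u v : E} (h : T.Gen u v) {s : ℝ}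
    (hs : 0 ≤ s) :
    HasDerivWithinAt (fun s : ℝ => T.op s.toNNReal u) (T.op s.toNNReal v) (Ioi s) s := by
  rw [hasDerivWithinAt_iff_tendsto_slope' (by simp)]
  have h1 := ((T.op s.toNNReal).continuous.tendsto v).comp ((T.gen_iff_real u v).1 h)
  have h2 : Tendsto (fun x : ℝ => x - s) (𝓝[>] s) (𝓝[>] 0) := by
    refine tendsto_nhdsWithin_iff.2 ⟨?_, ?_⟩
    · have : Tendsto (fun x : ℝ => x - s) (𝓝 s) (𝓝 (s - s)) := by
        exact (continuous_id.sub continuous_const).tendsto s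
      rw [sub_self] at this
      exact this.mono_left nhdsWithin_le_nhds
    · filter_upwards [self_mem_nhdsWithin] with x hx
      exact sub_pos.2 (mem_Ioi.1 hx)
  refine (h1.comp h2).congr' ?_
  filter_upwards [self_mem_nhdsWithin] with x hx
  have hx' : s < x := hx
  have e : x.toNNReal = s.toNNReal + (x - s).toNNReal := by
    rw [← Real.toNNReal_add hs (by linarith)]; congr 1; ring
  simp only [Function.comp_apply, slope_def_module, map_smul, map_sub, e, T.op_add,
    ContinuousLinearMap.comp_apply]

theorem C0Semigroup.Gen.integral_eq [CompleteSpace E] {T : C0Semigroup E} {u v : E}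
    (h : T.Gen u v) {t : ℝ} (ht : 0 ≤ t) :
    ∫ s in (0 : ℝ)..t, T.op s.toNNReal v = T.op t.toNNReal u - u := by
  rw [intervalIntegral.integral_eq_sub_of_hasDeriv_right_of_le ht
    (T.continuous_orbit_real u).continuousOn (fun x hx => h.hasDerivWithinAt hx.1.le)
    ((T.continuous_orbit_real v).intervalIntegrable _ _), Real.toNNReal_zero, T.op_zero]
  rfl

/-- Converse of the integral identity, by differentiation at `0`: membership in the generator
becomes a family of identities without difference quotients, and these pass to limits. -/
theorem C0Semigroup.gen_of_integral_eq [CompleteSpace E] {T : C0Semigroup E} {u v : E}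
    (h : ∀ t : ℝ, 0 ≤ t → ∫ s in (0 : ℝ)..t, T.op s.toNNReal v = T.op t.toNNReal u - u) :
    T.Gen u v := by
  rw [C0Semigroup.gen_iff_real]
  have h1 : HasDerivAt (fun t : ℝ => ∫ s in (0 : ℝ)..t, T.op s.toNNReal v)
      (T.op (0 : ℝ).toNNReal v) 0 :=
    intervalIntegral.integral_hasDerivAt_right (by simp)
      ((T.continuous_orbit_real v).stronglyMeasurableAtFilter _ _)
      (T.continuous_orbit_real v).continuousAt
  rw [hasDerivAt_iff_tendsto_slope, Real.toNNReal_zero, T.op_zero] at h1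
  refine (h1.mono_left (nhdsWithin_mono 0 fun x (hx : 0 < x) => hx.ne')).congr' ?_
  filter_upwards [self_mem_nhdsWithin] with x hx
  rw [slope_def_module, h x (le_of_lt hx)]
  simp

/-- The generator of a contraction semigroup is closed. -/
theorem C0Semigroup.isClosed_gen [CompleteSpace E] {T : C0Semigroup E}
    (hT : ∀ t, ‖T.op t‖ ≤ 1) : IsClosed {p : E × E | T.Gen p.1 p.2} := by
  have : {p : E × E | T.Gen p.1 p.2} = ⋂ t ∈ Ici (0 : ℝ), {p : E × E |
      ∫ s in (0 : ℝ)..t, T.op s.toNNReal p.2 = T.op t.toNNReal p.1 - p.1} := by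
    ext p
    simp only [mem_ofPred_eq, mem_iInter]
    exact ⟨fun h t ht => h.integral_eq ht, fun h => C0Semigroup.gen_of_integral_eq h⟩
  rw [this]
  refine isClosed_biInter fun t ht => ?_
  refine isClosed_eq (Continuous.comp (g := fun v => ∫ s in (0 : ℝ)..t, T.op s.toNNReal v) ?_
    continuous_snd) (by fun_prop)
  have ht' : (0 : ℝ) ≤ t := ht
  -- Contractivity makes `v ↦ ∫₀^t T_s v ds` Lipschitz with constant `t`.
  refine (LipschitzWith.of_dist_le_mul (K := t.toNNReal) fun v w => ?_).continuous
  rw [dist_eq_norm, dist_eq_norm, ← intervalIntegral.integral_sub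
    ((T.continuous_orbit_real v).intervalIntegrable _ _)
    ((T.continuous_orbit_real w).intervalIntegrable _ _), Real.coe_toNNReal t ht']
  have := intervalIntegral.norm_integral_le_of_norm_le_const (a := (0 : ℝ)) (b := t)
    (C := ‖v - w‖) (f := fun s => T.op s.toNNReal v - T.op s.toNNReal w) fun s _ => by
      rw [← map_sub]
      exact ((T.op _).le_of_opNorm_le (hT _) _).trans (by rw [one_mul])
  rwa [sub_zero, abs_of_nonneg ht', mul_comm] at this

/-- If the orbit of a generator value decays exponentially and the orbit itself tends to zero,
the generator is bounded from below. -/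
theorem C0Semigroup.Gen.norm_le [CompleteSpace E] {T : C0Semigroup E} {u v : E} (h : T.Gen u v)
    {C b : ℝ} (hb : 0 < b) (hu : ∀ t : ℝ≥0, ‖T.op t u‖ ≤ C * Real.exp (-b * t) * ‖u‖)
    (hv : ∀ t : ℝ≥0, ‖T.op t v‖ ≤ C * Real.exp (-b * t) * ‖v‖) : ‖u‖ ≤ C / b * ‖v‖ := by
  have hC : 0 ≤ C * ‖v‖ := by
    have := (norm_nonneg _).trans (hv 0)
    simpa using this
  -- From `u = T_t u - ∫₀^t T_s v ds` and `∫₀^∞ e^{-bs} ds = 1/b`; the first term disappears as `t →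
  -- ∞`.
  have key : ∀ t : ℝ, 0 ≤ t → ‖u‖ ≤ C * Real.exp (-b * t) * ‖u‖ + C / b * ‖v‖ := by
    intro t ht
    have h1 := h.integral_eq ht
    have h2 : ‖∫ s in (0 : ℝ)..t, T.op s.toNNReal v‖ ≤
        ∫ s in (0 : ℝ)..t, C * ‖v‖ * Real.exp (-b * s) := by
      refine intervalIntegral.norm_integral_le_of_norm_le ht ?_
        (Continuous.intervalIntegrable (by fun_prop) _ _)
      refine Eventually.of_forall fun s hs => ?_
      have := hv s.toNNReal
      rw [Real.coe_toNNReal s hs.1.le] at this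
      linarith
    have h3 : ∫ s in (0 : ℝ)..t, C * ‖v‖ * Real.exp (-b * s) =
        C * ‖v‖ * ((1 - Real.exp (-b * t)) / b) := by
      rw [intervalIntegral.integral_const_mul,
        intervalIntegral.integral_comp_mul_left (fun x => Real.exp x) (by linarith : -b ≠ 0),
        integral_exp]
      simp only [mul_zero, Real.exp_zero, smul_eq_mul]
      field_simp
      ring
    have h4 : u = T.op t.toNNReal u - ∫ s in (0 : ℝ)..t, T.op s.toNNReal v := by
      rw [h1]; abel
    have h5 : C * ‖v‖ * ((1 - Real.exp (-b * t)) / b) ≤ C / b * ‖v‖ := by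
      have : (1 - Real.exp (-b * t)) / b ≤ 1 / b := by
        gcongr
        linarith [Real.exp_pos (-b * t)]
      calc _ ≤ C * ‖v‖ * (1 / b) := by gcongr
        _ = _ := by ring
    calc ‖u‖ ≤ ‖T.op t.toNNReal u‖ + ‖∫ s in (0 : ℝ)..t, T.op s.toNNReal v‖ := by
          conv_lhs => rw [h4]
          exact norm_sub_le _ _
      _ ≤ _ := by
          have := hu t.toNNReal
          rw [Real.coe_toNNReal t ht] at this
          linarith
  have hlim : Tendsto (fun t : ℝ => C * Real.exp (-b * t) * ‖u‖ + C / b * ‖v‖) atTop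
      (𝓝 (C * 0 * ‖u‖ + C / b * ‖v‖)) := by
    refine ((Tendsto.const_mul C ?_).mul_const _).add_const _
    refine Real.tendsto_exp_atBot.comp ?_
    exact (tendsto_id.const_mul_atTop_of_neg (by linarith))
  rw [mul_zero, zero_mul, zero_add] at hlim
  refine ge_of_tendsto hlim ?_
  filter_upwards [eventually_ge_atTop 0] with t ht using key t ht

/-- If `S_t = F_t T_t` with bounded operators `F_t = 1 + t B + o(t)`, then the generator of `S` is
the generator of `T` plus `B`. -/
theorem C0Semigroup.gen_iff_of_factor {S T : C0Semigroup E} {F : ℝ≥0 → E →L[ℝ] E} {B : E →L[ℝ] E}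
    (hS : ∀ t, S.op t = (F t).comp (T.op t))
    (hF : Tendsto (fun t : ℝ≥0 => (t : ℝ)⁻¹ • (F t - ContinuousLinearMap.id ℝ E)) (𝓝[>] 0) (𝓝 B))
    (u v : E) : S.Gen u v ↔ T.Gen u (v - B u) := by
  have ht0 : Tendsto (fun t : ℝ≥0 => (t : ℝ)) (𝓝[>] 0) (𝓝 0) :=
    tendsto_coe_nhdsGT_zero.mono_right nhdsWithin_le_nhds
  have hne : ∀ᶠ t : ℝ≥0 in 𝓝[>] 0, (t : ℝ) ≠ 0 := by
    filter_upwards [self_mem_nhdsWithin] with t ht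
    exact (NNReal.coe_pos.2 ht).ne'
  have hF1 : Tendsto (fun t : ℝ≥0 => F t - ContinuousLinearMap.id ℝ E) (𝓝[>] 0) (𝓝 0) := by
    have := ht0.smul hF
    rw [zero_smul] at this
    refine this.congr' ?_
    filter_upwards [hne] with t ht
    rw [smul_inv_smul₀ ht]
  have hFu : Tendsto (fun t : ℝ≥0 => (t : ℝ)⁻¹ • (F t u - u)) (𝓝[>] 0) (𝓝 (B u)) := by
    have := ((ContinuousLinearMap.apply ℝ E u).continuous.tendsto B).comp hF
    exact this
  -- The last summand is the error: it tends to zero as soon as the quotients of `T` stay bounded,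
  -- since `F_t → 1` in norm.
  have split : ∀ t : ℝ≥0, (t : ℝ)⁻¹ • (S.op t u - u) =
      (t : ℝ)⁻¹ • (T.op t u - u) + (t : ℝ)⁻¹ • (F t u - u) +
        (F t - ContinuousLinearMap.id ℝ E) ((t : ℝ)⁻¹ • (T.op t u - u)) := by
    intro t
    rw [hS t, map_smul, ← smul_add, ← smul_add]
    congr 1
    simp only [ContinuousLinearMap.comp_apply, sub_apply,
      ContinuousLinearMap.id_apply, map_sub]
    abel
  have happ : ∀ {w : ℝ≥0 → E} {b : ℝ}, (∀ᶠ t in 𝓝[>] 0, ‖w t‖ ≤ b) →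
      Tendsto (fun t => (F t - ContinuousLinearMap.id ℝ E) (w t)) (𝓝[>] 0) (𝓝 0) := by
    intro w b hw
    have h0 : Tendsto (fun t : ℝ≥0 => ‖F t - ContinuousLinearMap.id ℝ E‖ * b) (𝓝[>] 0) (𝓝 0) := by
      simpa using hF1.norm.mul_const b
    refine squeeze_zero_norm' ?_ h0
    filter_upwards [hw] with t ht
    exact (ContinuousLinearMap.le_opNorm _ _).trans (by gcongr)
  constructor
  · intro h
    have hr : Tendsto (fun t : ℝ≥0 => (t : ℝ)⁻¹ • (S.op t u - u) - (t : ℝ)⁻¹ • (F t u - u))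
        (𝓝[>] 0) (𝓝 (v - B u)) := Tendsto.sub h hFu
    -- Boundedness of the quotients of `T` is not given here. Once `‖F_t - 1‖ ≤ 1/2`, the error term
    -- is at most half of the quotient and is absorbed, which explains the factor `2`.
    have hb : ∀ᶠ t : ℝ≥0 in 𝓝[>] 0,
        ‖(t : ℝ)⁻¹ • (T.op t u - u)‖ ≤ 2 * (‖v - B u‖ + 1) := by
      filter_upwards [hr.norm.eventually_le_const (lt_add_one _),
        hF1.norm.eventually_le_const (by simp : ‖(0 : E →L[ℝ] E)‖ < 1 / 2)] with t h1 h2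
      have h3 := (F t - ContinuousLinearMap.id ℝ E).le_of_opNorm_le h2
        ((t : ℝ)⁻¹ • (T.op t u - u))
      have h4 : (t : ℝ)⁻¹ • (T.op t u - u) =
          ((t : ℝ)⁻¹ • (S.op t u - u) - (t : ℝ)⁻¹ • (F t u - u)) -
            (F t - ContinuousLinearMap.id ℝ E) ((t : ℝ)⁻¹ • (T.op t u - u)) := by
        rw [split t]; abel
      have h5 : ‖(t : ℝ)⁻¹ • (T.op t u - u)‖ ≤
          ‖(t : ℝ)⁻¹ • (S.op t u - u) - (t : ℝ)⁻¹ • (F t u - u)‖ +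
            ‖(F t - ContinuousLinearMap.id ℝ E) ((t : ℝ)⁻¹ • (T.op t u - u))‖ := by
        conv_lhs => rw [h4]
        exact norm_sub_le _ _
      linarith
    have := hr.sub (happ hb)
    rw [sub_zero] at this
    refine this.congr fun t => ?_
    rw [split t]; abel
  · intro h
    have h1 : Tendsto (fun t : ℝ≥0 => (t : ℝ)⁻¹ • (T.op t u - u)) (𝓝[>] 0) (𝓝 (v - B u)) := h
    have := (h1.add hFu).add (happ (h1.norm.eventually_le_const (lt_add_one _)))
    rw [add_zero, sub_add_cancel] at this
    exact this.congr fun t => (split t).symm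

end Semigroup

end Coagulation

namespace Coagulation

/-! ### The dilation semigroup -/

theorem ae_comp_mul_left {p : ℝ → Prop} {c : ℝ} (hc : 0 < c)
    (h : ∀ᵐ x ∂(volume.restrict (Ioi (0 : ℝ))), p x) :
    ∀ᵐ x ∂(volume.restrict (Ioi (0 : ℝ))), p (c * x) := by
  rw [ae_restrict_iff' measurableSet_Ioi] at h ⊢
  have hq : Measure.QuasiMeasurePreserving (fun x : ℝ => c * x) volume volume := by
    refine ⟨by fun_prop, ?_⟩
    rw [Real.map_volume_mul_left hc.ne']
    exact Measure.smul_absolutelyContinuous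
  filter_upwards [hq.ae h] with x hx h0
  exact hx (mul_pos hc h0)

theorem integrableOn_mul_shrunk_weight {k : ℝ} (hk : 0 ≤ k) {c : ℝ} (hc : 1 ≤ c) {f : ℝ → ℝ}
    (hf : Integrable f (weightMeasure k)) :
    IntegrableOn (fun x => f x * (1 + c⁻¹ * x) ^ k) (Ioi 0) := by
  have hc0 : 0 < c := by linarith
  have := integrableOn_mul_of_weight (g := fun x => (1 + c⁻¹ * x) ^ k) hf
    (by fun_prop) fun x hx => by
      have h1 : 0 ≤ c⁻¹ * x := by positivity
      rw [abs_of_nonneg (by positivity)]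
      refine Real.rpow_le_rpow (by positivity) ?_ hk
      have : c⁻¹ ≤ 1 := inv_le_one_of_one_le₀ hc
      nlinarith
  simpa only [mul_comm] using this

theorem integrable_comp_mul_left {k : ℝ} (hk : 0 ≤ k) {c : ℝ} (hc : 1 ≤ c) {f : ℝ → ℝ}
    (hf : Integrable f (weightMeasure k)) : Integrable (fun x => f (c * x)) (weightMeasure k) := by
  have hc0 : 0 < c := by linarith
  rw [integrable_weight_iff]
  have h1 := integrableOn_mul_shrunk_weight hk hc hf
  have h2 := (integrableOn_Ioi_comp_mul_left_iff
    (fun x => f x * (1 + c⁻¹ * x) ^ k) 0 hc0).2 (by simpa using h1)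
  simpa only [inv_mul_cancel_left₀ hc0.ne'] using h2

/-- Substitution produces the factor `c⁻¹` and the weight at `c⁻¹ x`, which only decreases for `c ≥
1`. -/
theorem integral_abs_comp_mul_left_le {k : ℝ} (hk : 0 ≤ k) {c : ℝ} (hc : 1 ≤ c) {f : ℝ → ℝ}
    (hf : Integrable f (weightMeasure k)) :
    ∫ x in Ioi (0 : ℝ), |f (c * x)| * (1 + x) ^ k ≤
      c⁻¹ * ∫ x in Ioi (0 : ℝ), |f x| * (1 + x) ^ k := by
  have hc0 : 0 < c := by linarith
  have h2 := integral_comp_mul_left_Ioi (fun x => |f x| * (1 + c⁻¹ * x) ^ k) 0 hc0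
  simp only [inv_mul_cancel_left₀ hc0.ne', mul_zero, smul_eq_mul] at h2
  rw [h2]
  refine mul_le_mul_of_nonneg_left ?_ (by positivity)
  refine setIntegral_mono_on (integrableOn_mul_shrunk_weight hk hc hf.abs)
    (integrable_weight_iff.1 hf.abs) measurableSet_Ioi fun x hx => ?_
  have hx0 : (0 : ℝ) < x := hx
  have : c⁻¹ ≤ 1 := inv_le_one_of_one_le₀ hc
  gcongr
  nlinarith

theorem one_le_exp_coe (t : ℝ≥0) : 1 ≤ Real.exp t := Real.one_le_exp t.2

/-- The dilation `h ↦ h(e^t ·)` on `L¹((1+x)^k)`. -/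
noncomputable def dilation {k : ℝ} (hk : 0 ≤ k) (t : ℝ≥0) : L1w k →L[ℝ] L1w k :=
  LinearMap.mkContinuous
    { toFun := fun h => (integrable_comp_mul_left hk (one_le_exp_coe t) (integrable_coe h)).toL1
        (fun x => h (Real.exp t * x))
      map_add' := fun f g => by
        rw [toL1_eq_iff_weight]
        have h1 : ∀ᵐ x ∂(volume.restrict (Ioi (0 : ℝ))), (f + g : L1w k) x = f x + g x :=
          ae_weight_iff.1 (Lp.coeFn_add f g)
        filter_upwards [ae_comp_mul_left (Real.exp_pos t) h1, ae_weight_iff.1 (Lp.coeFn_add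
          ((integrable_comp_mul_left hk (one_le_exp_coe t) (integrable_coe f)).toL1
            (fun x => f (Real.exp t * x)))
          ((integrable_comp_mul_left hk (one_le_exp_coe t) (integrable_coe g)).toL1
            (fun x => g (Real.exp t * x)))),
          coeFn_toL1_weight (integrable_comp_mul_left hk (one_le_exp_coe t) (integrable_coe f)),
          coeFn_toL1_weight (integrable_comp_mul_left hk (one_le_exp_coe t) (integrable_coe g))]
          with x e1 e2 e3 e4
        rw [e1, e2, Pi.add_apply, e3, e4]
      map_smul' := fun r f => by
        rw [toL1_eq_iff_weight]
        have h1 : ∀ᵐ x ∂(volume.restrict (Ioi (0 : ℝ))), (r • f : L1w k) x = r * f x :=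
          ae_weight_iff.1 (Lp.coeFn_smul r f)
        filter_upwards [ae_comp_mul_left (Real.exp_pos t) h1, ae_weight_iff.1 (Lp.coeFn_smul r
          ((integrable_comp_mul_left hk (one_le_exp_coe t) (integrable_coe f)).toL1
            (fun x => f (Real.exp t * x)))),
          coeFn_toL1_weight (integrable_comp_mul_left hk (one_le_exp_coe t) (integrable_coe f))]
          with x e1 e2 e3
        rw [e1, RingHom.id_apply, e2, Pi.smul_apply, e3, smul_eq_mul] }
    (Real.exp (-t)) fun h => by
      simp only [LinearMap.coe_mk, AddHom.coe_mk]
      rw [norm_toL1_weight, norm_eq_integral_weight, Real.exp_neg]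
      exact integral_abs_comp_mul_left_le hk (one_le_exp_coe t) (integrable_coe h)

theorem norm_dilation_le {k : ℝ} (hk : 0 ≤ k) (t : ℝ≥0) : ‖dilation hk t‖ ≤ Real.exp (-t) :=
  LinearMap.mkContinuous_norm_le _ (Real.exp_pos _).le _

theorem norm_dilation_apply_le {k : ℝ} (hk : 0 ≤ k) (t : ℝ≥0) (h : L1w k) :
    ‖dilation hk t h‖ ≤ Real.exp (-t) * ‖h‖ :=
  ContinuousLinearMap.le_of_opNorm_le _ (norm_dilation_le hk t) h

theorem norm_dilation_le_one {k : ℝ} (hk : 0 ≤ k) (t : ℝ≥0) : ‖dilation hk t‖ ≤ 1 :=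
  (norm_dilation_le hk t).trans (Real.exp_le_one_iff.2 (by simp))

theorem coeFn_dilation {k : ℝ} (hk : 0 ≤ k) (t : ℝ≥0) (h : L1w k) :
    ∀ᵐ x ∂(volume.restrict (Ioi (0 : ℝ))), dilation hk t h x = h (Real.exp t * x) :=
  coeFn_toL1_weight (integrable_comp_mul_left hk (one_le_exp_coe t) (integrable_coe h))

theorem dilation_toL1 {k : ℝ} (hk : 0 ≤ k) (t : ℝ≥0) {f : ℝ → ℝ}
    (hf : Integrable f (weightMeasure k)) :
    dilation hk t (hf.toL1 f) =
      (integrable_comp_mul_left hk (one_le_exp_coe t) hf).toL1 (fun x => f (Real.exp t * x)) := by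
  symm
  rw [toL1_eq_iff_weight]
  filter_upwards [coeFn_dilation hk t (hf.toL1 f),
    ae_comp_mul_left (Real.exp_pos t) (coeFn_toL1_weight hf)] with x e1 e2
  rw [e1, e2]

theorem lp_ext_weight {k : ℝ} {f g : L1w k}
    (h : ∀ᵐ x ∂(volume.restrict (Ioi (0 : ℝ))), f x = g x) : f = g :=
  Lp.ext (ae_weight_iff.2 h)

theorem dilation_zero {k : ℝ} (hk : 0 ≤ k) : dilation hk 0 = ContinuousLinearMap.id ℝ (L1w k) := by
  ext1 h
  refine lp_ext_weight ?_
  filter_upwards [coeFn_dilation hk 0 h] with x e1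
  rw [e1]
  simp

theorem dilation_add {k : ℝ} (hk : 0 ≤ k) (s t : ℝ≥0) :
    dilation hk (s + t) = (dilation hk s).comp (dilation hk t) := by
  ext1 h
  refine lp_ext_weight ?_
  filter_upwards [coeFn_dilation hk (s + t) h, coeFn_dilation hk s (dilation hk t h),
    ae_comp_mul_left (Real.exp_pos s) (coeFn_dilation hk t h)] with x e1 e2 e3
  rw [e1, ContinuousLinearMap.comp_apply, e2, e3, ← mul_assoc, ← Real.exp_add]
  congr 3
  push_cast
  ring

theorem integrable_indicator_Icc_weight (k R M : ℝ) :
    Integrable (indicator (Icc 0 R) fun _ => M) (weightMeasure k) := by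
  rw [integrable_indicator_iff measurableSet_Icc]
  exact integrableOn_const isCompact_Icc.measure_lt_top.ne

theorem TestFn.exists_abs_le (φ : TestFn) : ∃ M : ℝ, 0 ≤ M ∧ ∀ x, |φ x| ≤ M := by
  obtain ⟨M, hM⟩ := φ.hasCompactSupport.exists_bound_of_continuous φ.continuous
  exact ⟨M, (norm_nonneg _).trans (hM 0), hM⟩

/-- The dilation of a test function. -/
noncomputable def TestFn.dil (φ : TestFn) (t : ℝ) : TestFn :=
  TestFn.mkOfBounds (fun x => φ (Real.exp t * x))
    (φ.contDiff_infty.comp (contDiff_const.mul contDiff_id)) <| by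
      obtain ⟨r, R, hr, h⟩ := φ.exists_bounds
      refine ⟨r * Real.exp (-t), R * Real.exp (-t), by positivity, fun x hx => h _ fun hh => hx ?_⟩
      rw [Real.exp_neg]
      constructor
      · rw [← div_eq_mul_inv, div_le_iff₀ (Real.exp_pos t)]
        linarith [hh.1]
      · rw [← div_eq_mul_inv, le_div_iff₀ (Real.exp_pos t)]
        linarith [hh.2]

@[simp] theorem TestFn.dil_apply (φ : TestFn) (t x : ℝ) : φ.dil t x = φ (Real.exp t * x) := rfl

theorem dilation_testIncl {k : ℝ} (hk : 0 ≤ k) (t : ℝ≥0) (φ : TestFn) :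
    dilation hk t (testIncl k φ) = testIncl k (φ.dil t) :=
  dilation_toL1 hk t (φ.integrable_weight k)

/-- The function `x ↦ x φ'(x)` as a test function. -/
noncomputable def TestFn.euler (φ : TestFn) : TestFn :=
  TestFn.mkOfBounds (fun x => x * deriv φ x)
    (contDiff_id.mul (by
      have := φ.contDiff_infty
      exact (contDiff_infty_iff_deriv.1 this).2)) <| by
      obtain ⟨r, R, hr, h⟩ := φ.exists_bounds
      refine ⟨r, R, hr, fun x hx => ?_⟩
      have : (φ : ℝ → ℝ) =ᶠ[𝓝 x] fun _ => 0 := by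
        filter_upwards [isClosed_Icc.isOpen_compl.mem_nhds hx] with y hy using h y hy
      rw [this.deriv_eq, deriv_const, mul_zero]

@[simp] theorem TestFn.euler_apply (φ : TestFn) (x : ℝ) : φ.euler x = x * deriv φ x := rfl

theorem TestFn.hasDerivAt (φ : TestFn) (x : ℝ) : HasDerivAt φ (deriv φ x) x :=
  (φ.contDiff_infty.differentiable (by simp) x).hasDerivAt

theorem TestFn.hasDerivAt_dil (φ : TestFn) (x s : ℝ) :
    HasDerivAt (fun s => φ (Real.exp s * x)) (φ.euler (Real.exp s * x)) s := by
  have h1 : HasDerivAt (fun s => Real.exp s * x) (Real.exp s * x) s :=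
    (Real.hasDerivAt_exp s).mul_const x
  have := (φ.hasDerivAt (Real.exp s * x)).comp s h1
  rw [TestFn.euler_apply, mul_comm]
  exact this

theorem TestFn.dil_sub_abs_le (φ : TestFn) {M : ℝ} (hM : ∀ x, |φ.euler x| ≤ M) (x t : ℝ)
    (ht : 0 ≤ t) : |φ (Real.exp t * x) - φ x| ≤ M * t := by
  have := Convex.norm_image_sub_le_of_norm_hasDerivWithin_le (s := univ)
    (f := fun s => φ (Real.exp s * x)) (f' := fun s => φ.euler (Real.exp s * x)) (x := 0) (y := t)
    (C := M) (fun s _ => (φ.hasDerivAt_dil x s).hasDerivWithinAt) (fun s _ => hM _) convex_univ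
    (mem_univ _) (mem_univ _)
  simpa [abs_of_nonneg ht] using this

theorem TestFn.abs_le_indicator (φ : TestFn) {M R : ℝ} (hM : ∀ x, |φ x| ≤ M)
    (hR : ∀ x, R ≤ x → φ x = 0) {c x : ℝ} (hc : 1 ≤ c) (hx : 0 < x) :
    |φ (c * x)| ≤ indicator (Icc 0 R) (fun _ => M) x := by
  by_cases h : x ∈ Icc 0 R
  · rw [indicator_of_mem h]; exact hM _
  · rw [indicator_of_notMem h]
    have hxR : R < x := by
      by_contra hh
      exact h ⟨hx.le, not_lt.1 hh⟩
    rw [hR, abs_zero]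
    nlinarith

/-- Dominated convergence settles test functions; since dilations are contractions, a general orbit
is a uniform limit of such orbits. -/
theorem continuous_dilation_orbit {k : ℝ} (hk : 0 ≤ k) (u : L1w k) :
    Continuous fun t => dilation hk t u := by
  have htest : ∀ φ : TestFn, Continuous fun t => dilation hk t (testIncl k φ) := by
    intro φ
    obtain ⟨M, -, hM⟩ := φ.exists_abs_le
    obtain ⟨R, -, hR⟩ := φ.exists_bound
    refine continuous_iff_continuousAt.2 fun t => ?_
    simp only [ContinuousAt, dilation_testIncl]
    refine tendsto_toL1_of_dominated (k := k) (F := fun (s : ℝ≥0) x => φ.dil s x)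
      (f := φ.dil t) (g := indicator (Icc 0 R) fun _ => M)
      (fun s => (φ.dil s).integrable_weight k) ((φ.dil t).integrable_weight k)
      (integrable_indicator_Icc_weight k R M) ?_ ?_
    · exact Eventually.of_forall fun s x hx => φ.abs_le_indicator hM hR (one_le_exp_coe s) hx
    · intro x _
      have : Continuous fun s : ℝ≥0 => φ (Real.exp s * x) := φ.continuous.comp (by fun_prop)
      exact this.tendsto t
  refine continuous_of_uniform_approx_of_continuous fun U hU => ?_
  obtain ⟨ε, hε, hεU⟩ := Metric.mem_uniformity_dist.1 hU
  obtain ⟨φ, hφ⟩ := (dense_range_testIncl k).exists_dist_lt u hε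
  refine ⟨_, htest φ, fun t => hεU ?_⟩
  rw [dist_eq_norm, ← map_sub]
  refine lt_of_le_of_lt (ContinuousLinearMap.le_of_opNorm_le _ (norm_dilation_le_one hk t) _) ?_
  rwa [one_mul, ← dist_eq_norm]

/-- The dilations form a strongly continuous semigroup. -/
noncomputable def dilationSemigroup {k : ℝ} (hk : 0 ≤ k) : C0Semigroup (L1w k) where
  op := dilation hk
  op_zero := dilation_zero hk
  op_add := dilation_add hk
  continuous_orbit := continuous_dilation_orbit hk

/-! ### The generator of the dilation semigroup and its core -/

theorem gen_dilation_testIncl {k : ℝ} (hk : 0 ≤ k) (φ : TestFn) :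
    (dilationSemigroup hk).Gen (testIncl k φ) (testIncl k φ.euler) := by
  obtain ⟨M, -, hM⟩ := φ.euler.exists_abs_le
  obtain ⟨R, -, hR⟩ := φ.exists_bound
  have hi : ∀ t : ℝ≥0, Integrable (fun x => (t : ℝ)⁻¹ * (φ.dil t x - φ x)) (weightMeasure k) :=
    fun t => (((φ.dil t).integrable_weight k).sub (φ.integrable_weight k)).const_mul _
  have := tendsto_toL1_of_dominated (l := 𝓝[>] (0 : ℝ≥0)) hi (φ.euler.integrable_weight k)
    (integrable_indicator_Icc_weight k R M) ?_ ?_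
  · refine this.congr fun t => ?_
    have h1 : (hi t).toL1 (fun x => (t : ℝ)⁻¹ * (φ.dil t x - φ x)) =
        (t : ℝ)⁻¹ • (testIncl k (φ.dil t) - testIncl k φ) := rfl
    rw [h1, ← dilation_testIncl hk]
    rfl
  -- The quotients are dominated by `sup |x φ'|` on `[0,R]`: since `e^t ≥ 1`, dilation does not push
  -- the support beyond `R`. At `t = 0` the convention `0⁻¹ = 0` keeps the bound valid.
  · refine Eventually.of_forall fun t x hx => ?_
    by_cases h : x ∈ Icc 0 R
    · rw [indicator_of_mem h, abs_mul, abs_of_nonneg (by positivity)]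
      have h1 := φ.dil_sub_abs_le hM x t t.2
      rcases eq_or_ne t 0 with rfl | ht
      · simpa using (abs_nonneg _).trans (hM 0)
      · have ht' : (0 : ℝ) < t := by positivity
        rw [inv_mul_le_iff₀ ht', mul_comm]
        exact h1
    · rw [indicator_of_notMem h]
      have hxR : R < x := by
        by_contra hh
        exact h ⟨hx.le, not_lt.1 hh⟩
      rw [TestFn.dil_apply, hR x hxR.le, hR]
      · simp
      · have := one_le_exp_coe t
        nlinarith
  · intro x _
    have h1 := (φ.hasDerivAt_dil x 0)
    rw [hasDerivAt_iff_tendsto_slope] at h1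
    have h2 := (h1.mono_left (nhdsWithin_mono 0 fun y (hy : 0 < y) => hy.ne')).comp
      tendsto_coe_nhdsGT_zero
    simp only [Real.exp_zero, one_mul] at h2
    refine h2.congr fun t => ?_
    simp [slope_def_module]

/-- Since `‖D_t‖ ≤ e^{-t}`, the lower bound holds with constant `1`. It turns density of the range
on test functions into the core property. -/
theorem norm_le_of_gen_dilation {k : ℝ} (hk : 0 ≤ k) {u w : L1w k}
    (h : (dilationSemigroup hk).Gen u w) : ‖u‖ ≤ ‖w‖ := by
  have := h.norm_le (C := 1) (b := 1) one_pos
    (fun t => by simpa using! norm_dilation_apply_le hk t u)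
    (fun t => by simpa using! norm_dilation_apply_le hk t w)
  simpa using this

/-- A test function `ψ` with `∫ ψ(y)/y dy = 0` is of the form `x φ'(x)`. -/
theorem TestFn.exists_euler_eq (ψ : TestFn) (h : ∫ y in Ioi (0 : ℝ), ψ y / y = 0) :
    ∃ φ : TestFn, φ.euler = ψ := by
  obtain ⟨r, R, hr, hψ⟩ := ψ.exists_bounds
  have hψ0 : ∀ x, x < r → ψ x = 0 := fun x hx => hψ x fun hh => not_le.2 hx hh.1
  -- The candidate is the primitive of `ψ(y)/y` from `0`; the hypothesis makes it vanish to the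
  -- right of the support.
  set g : ℝ → ℝ := fun y => ψ y / y with hg
  have hgs : ContDiff ℝ ((⊤ : ℕ∞) : WithTop ℕ∞) g := by
    refine contDiff_iff_contDiffAt.2 fun x => ?_
    rcases lt_or_ge x r with hx | hx
    · refine (contDiffAt_const (c := (0 : ℝ))).congr_of_eventuallyEq ?_
      filter_upwards [Iio_mem_nhds hx] with y hy
      rw [hg]
      simp only
      rw [hψ0 y hy, zero_div]
    · exact ψ.contDiff_infty.contDiffAt.div contDiffAt_id (by linarith)
  have hgz : ∀ x, x ∉ Icc r R → g x = 0 := fun x hx => by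
    rw [hg]; simp only; rw [hψ x hx, zero_div]
  have hgi : ∀ a b, IntervalIntegrable g volume a b := fun a b =>
    hgs.continuous.intervalIntegrable a b
  set f : ℝ → ℝ := fun x => ∫ y in (0 : ℝ)..x, g y with hf
  have hfd : ∀ x, HasDerivAt f (g x) x := fun x =>
    intervalIntegral.integral_hasDerivAt_right (hgi 0 x)
      (hgs.continuous.stronglyMeasurableAtFilter _ _) hgs.continuous.continuousAt
  have hfs : ContDiff ℝ ((⊤ : ℕ∞) : WithTop ℕ∞) f := by
    refine contDiff_infty_iff_deriv.2 ⟨fun x => (hfd x).differentiableAt, ?_⟩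
    rwa [show deriv f = g from funext fun x => (hfd x).deriv]
  have hfz : ∀ x, x ∉ Icc r R → f x = 0 := by
    intro x hx
    rw [mem_Icc, not_and_or, not_le, not_le] at hx
    rcases hx with hx | hx
    · rw [hf]
      simp only
      rw [intervalIntegral.integral_congr (g := fun _ => (0 : ℝ)), intervalIntegral.integral_zero]
      intro y hy
      refine hgz y fun hh => ?_
      have := hy.2
      have hm : max 0 x < r := max_lt hr hx
      linarith [hh.1]
    · have hx' : max 0 R ≤ max 0 x := max_le_max le_rfl hx.le
      rcases le_total x 0 with hx0 | hx0
      · rw [hf]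
        simp only
        rw [intervalIntegral.integral_congr (g := fun _ => (0 : ℝ)), intervalIntegral.integral_zero]
        intro y hy
        refine hgz y fun hh => ?_
        have := hy.2
        rw [max_eq_left hx0] at this
        linarith [hh.1]
      · rw [hf]
        simp only
        rw [intervalIntegral.integral_of_le hx0]
        refine Eq.trans (setIntegral_eq_of_subset_of_forall_sdiff_eq_zero measurableSet_Ioi
          Ioc_subset_Ioi_self fun y hy => hgz y fun hh => hy.2 ⟨hy.1, ?_⟩).symm h
        linarith [hh.2]
  refine ⟨TestFn.mkOfBounds f hfs ⟨r, R, hr, hfz⟩, TestFunction.ext fun x => ?_⟩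
  rw [TestFn.euler_apply, TestFn.coe_mkOfBounds, (hfd x).deriv, hg]
  simp only
  rcases lt_or_ge x r with hx | hx
  · rw [hψ0 x hx]; simp
  · exact mul_div_cancel₀ _ (by linarith)

theorem TestFn.integrableOn_div (ψ : TestFn) : IntegrableOn (fun y => ψ y / y) (Ioi 0) := by
  obtain ⟨r, R, hr, hψ⟩ := ψ.exists_bounds
  have : IntegrableOn (fun y => ψ y / y) (Icc r R) := by
    refine ContinuousOn.integrableOn_Icc (ψ.continuous.continuousOn.div continuousOn_id ?_)
    intro x hx
    linarith [hx.1]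
  refine (IntegrableOn.of_forall_sdiff_eq_zero this MeasurableSet.univ fun x hx => ?_).mono_set
    (subset_univ _)
  rw [hψ x hx.2, zero_div]

/-- The measure `dy/y` is invariant under dilations, while the weighted norm shrinks under them;
density of the range rests on this contrast. -/
theorem TestFn.integral_dil_div (ψ : TestFn) (t : ℝ) :
    ∫ y in Ioi (0 : ℝ), ψ.dil t y / y = ∫ y in Ioi (0 : ℝ), ψ y / y := by
  have := integral_comp_mul_left_Ioi (fun y => ψ y / y) 0 (Real.exp_pos t)
  rw [mul_zero] at this
  rw [eq_inv_smul_iff₀ (Real.exp_pos t).ne', smul_eq_mul, ← integral_const_mul] at this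
  rw [← this]
  refine setIntegral_congr_fun measurableSet_Ioi fun y hy => ?_
  have hy0 : (0 : ℝ) < y := hy
  have := Real.exp_pos t
  simp only [TestFn.dil_apply]
  field_simp

theorem TestFn.exists_integral_div_eq_one : ∃ η : TestFn, ∫ y in Ioi (0 : ℝ), η y / y = 1 := by
  let b : ContDiffBump (2 : ℝ) := ⟨1 / 2, 1, by norm_num, by norm_num⟩
  have hb : ∀ x, x ∉ Icc (1 : ℝ) 3 → b x = 0 := by
    intro x hx
    refine b.zero_of_le_dist ?_
    rw [Real.dist_eq]
    by_contra hh
    rw [not_le, abs_lt] at hh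
    have h1 : b.rOut = 1 := rfl
    exact hx ⟨by linarith [hh.1], by linarith [hh.2]⟩
  have hpos : 0 < ∫ x, b x := b.integral_pos
  refine ⟨TestFn.mkOfBounds (fun x => (∫ x, b x)⁻¹ * (x * b x))
    (contDiff_const.mul (contDiff_id.mul b.contDiff)) ⟨1, 3, one_pos, fun x hx => ?_⟩, ?_⟩
  · rw [hb x hx]; simp
  · have : ∀ y ∈ Ioi (0 : ℝ), (∫ x, b x)⁻¹ * (y * b y) / y = (∫ x, b x)⁻¹ * b y := by
      intro y hy
      have hy0 : (0 : ℝ) < y := hy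
      field_simp
    rw [TestFn.coe_mkOfBounds, setIntegral_congr_fun measurableSet_Ioi this, integral_const_mul,
      setIntegral_eq_integral_of_forall_compl_eq_zero, inv_mul_cancel₀ hpos.ne']
    intro x hx
    refine hb x fun hh => hx ?_
    have : (0 : ℝ) < x := by linarith [hh.1]
    exact this

/-- The only obstruction to solving `x φ' = ψ` is `c = ∫ ψ dy/y`. Subtracting `c D_t η`, with `∫ η
dy/y = 1`, removes it at the cost `|c| e^{-t} ‖η‖`, which is arbitrarily small. -/
theorem dense_range_euler {k : ℝ} (hk : 0 ≤ k) :
    DenseRange fun φ : TestFn => testIncl k φ.euler := by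
  refine Metric.denseRange_iff.2 fun w ε hε => ?_
  obtain ⟨η, hη⟩ := TestFn.exists_integral_div_eq_one
  obtain ⟨ψ, hψ⟩ := (dense_range_testIncl k).exists_dist_lt w (half_pos hε)
  set c := ∫ y in Ioi (0 : ℝ), ψ y / y with hc
  have hlim : Tendsto (fun t : ℝ≥0 => |c| * (Real.exp (-t) * ‖testIncl k η‖)) atTop (𝓝 0) := by
    have h1 : Tendsto (fun t : ℝ≥0 => Real.exp (-(t : ℝ))) atTop (𝓝 0) :=
      Real.tendsto_exp_neg_atTop_nhds_zero.comp (NNReal.tendsto_coe_atTop.2 tendsto_id)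
    simpa using (h1.mul_const ‖testIncl k η‖).const_mul |c|
  obtain ⟨t, ht⟩ := (hlim.eventually_lt_const (half_pos hε)).exists
  have hint : ∫ y in Ioi (0 : ℝ), (ψ - c • η.dil t : TestFn) y / y = 0 := by
    have : ∀ y, (ψ - c • η.dil t : TestFn) y / y = ψ y / y - c * (η.dil t y / y) := by
      intro y
      have : (ψ - c • η.dil t : TestFn) y = ψ y - c * η.dil t y := rfl
      rw [this]
      ring
    simp_rw [this]
    rw [integral_sub ψ.integrableOn_div ((η.dil t).integrableOn_div.const_mul c),
      integral_const_mul, TestFn.integral_dil_div, hη]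
    simp [hc]
  obtain ⟨φ, hφ⟩ := TestFn.exists_euler_eq _ hint
  refine ⟨φ, ?_⟩
  rw [hφ, map_sub, map_smul, dist_eq_norm]
  have h1 : ‖c • testIncl k (η.dil t)‖ < ε / 2 := by
    rw [norm_smul, Real.norm_eq_abs, ← dilation_testIncl hk]
    refine lt_of_le_of_lt ?_ ht
    gcongr
    exact norm_dilation_apply_le hk t _
  rw [dist_eq_norm] at hψ
  calc ‖w - (testIncl k ψ - c • testIncl k (η.dil t))‖
      = ‖(w - testIncl k ψ) + c • testIncl k (η.dil t)‖ := by congr 1; abel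
    _ ≤ _ := norm_add_le _ _
    _ < ε := by linarith

/-- The test functions are a core for the generator of the dilation semigroup. -/
theorem gen_dilation_iff {k : ℝ} (hk : 0 ≤ k) (u w : L1w k) :
    (dilationSemigroup hk).Gen u w ↔
      (u, w) ∈ closure (range fun φ : TestFn => (testIncl k φ, testIncl k φ.euler)) := by
  constructor
  · intro h
    refine Metric.mem_closure_range_iff.2 fun ε hε => ?_
    obtain ⟨φ, hφ⟩ := (dense_range_euler hk).exists_dist_lt w hε
    refine ⟨φ, ?_⟩
    rw [Prod.dist_eq]
    refine max_lt ?_ hφ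
    rw [dist_eq_norm] at hφ ⊢
    -- Approximating the image `w` alone is enough: the lower bound applied to the difference
    -- controls the approximation of `u`.
    exact lt_of_le_of_lt (norm_le_of_gen_dilation hk (h.sub (gen_dilation_testIncl hk φ))) hφ
  · intro h
    refine closure_minimal ?_ (C0Semigroup.isClosed_gen
      (T := dilationSemigroup hk) (norm_dilation_le_one hk)) h
    rintro _ ⟨φ, rfl⟩
    exact gen_dilation_testIncl hk φ

end Coagulation

namespace Coagulation

/-! ### Integral operators on the weighted space -/

/-- The function `x ↦ ∫₀^∞ K(x,z) f(z) dz`. -/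
noncomputable def kernelFun (K : ℝ → ℝ → ℝ) (f : ℝ → ℝ) (x : ℝ) : ℝ :=
  ∫ z in Ioi (0 : ℝ), K x z * f z

theorem kernelFun_congr {K : ℝ → ℝ → ℝ} {f g : ℝ → ℝ}
    (h : f =ᵐ[volume.restrict (Ioi (0 : ℝ))] g) : kernelFun K f = kernelFun K g := by
  ext x
  refine integral_congr_ae ?_
  filter_upwards [h] with z hz
  rw [hz]

/-- Tonelli bounds the operator through the weighted norms of its columns. The bound `n` stays a
function of `z`, so that its vanishing at `z = 0` can later be turned into decay. -/
theorem kernel_bound {k : ℝ} {K : ℝ → ℝ → ℝ} (hK : Measurable (Function.uncurry K)) {n : ℝ → ℝ}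
    (hn : ∀ z, 0 < z → 0 ≤ n z)
    (hN : ∀ z, 0 < z → ∫⁻ x, ‖K x z‖ₑ ∂(weightMeasure k) ≤ ENNReal.ofReal (n z)) {f : ℝ → ℝ}
    (hf : AEStronglyMeasurable f (volume.restrict (Ioi (0 : ℝ))))
    (hnf : IntegrableOn (fun z => n z * |f z|) (Ioi 0)) :
    Integrable (kernelFun K f) (weightMeasure k) ∧
      ∫ x in Ioi (0 : ℝ), |kernelFun K f x| * (1 + x) ^ k ≤ ∫ z in Ioi (0 : ℝ), n z * |f z| := by
  have hmeas : AEStronglyMeasurable (fun p : ℝ × ℝ => K p.1 p.2 * f p.2)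
      ((weightMeasure k).prod (volume.restrict (Ioi (0 : ℝ)))) :=
    hK.aestronglyMeasurable.mul hf.comp_snd
  have hmeas' : AEStronglyMeasurable (kernelFun K f) (weightMeasure k) :=
    hmeas.integral_prod_right'
  have hle : ∫⁻ x, ‖kernelFun K f x‖ₑ ∂(weightMeasure k) ≤
      ENNReal.ofReal (∫ z in Ioi (0 : ℝ), n z * |f z|) := by
    calc ∫⁻ x, ‖kernelFun K f x‖ₑ ∂(weightMeasure k)
        ≤ ∫⁻ x, (∫⁻ z in Ioi (0 : ℝ), ‖K x z * f z‖ₑ) ∂(weightMeasure k) :=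
          lintegral_mono fun x => enorm_integral_le_lintegral_enorm _
      _ = ∫⁻ z in Ioi (0 : ℝ), ∫⁻ x, ‖K x z * f z‖ₑ ∂(weightMeasure k) :=
          lintegral_lintegral_swap (f := fun x z => ‖K x z * f z‖ₑ) hmeas.enorm
      _ ≤ ∫⁻ z in Ioi (0 : ℝ), ENNReal.ofReal (n z * |f z|) := by
          refine setLIntegral_mono' measurableSet_Ioi fun z hz => ?_
          have h1 : ∀ x, ‖K x z * f z‖ₑ = ‖K x z‖ₑ * ‖f z‖ₑ := fun x => enorm_mul _ _
          simp_rw [h1]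
          rw [lintegral_mul_const' _ _ enorm_ne_top, ENNReal.ofReal_mul (hn z hz),
            Real.enorm_eq_ofReal_abs (f z)]
          gcongr
          exact hN z hz
      _ = ENNReal.ofReal (∫ z in Ioi (0 : ℝ), n z * |f z|) := by
          rw [ofReal_integral_eq_lintegral_ofReal hnf]
          filter_upwards [ae_restrict_mem measurableSet_Ioi] with z hz
          exact mul_nonneg (hn z hz) (abs_nonneg _)
  have hint : Integrable (kernelFun K f) (weightMeasure k) :=
    ⟨hmeas', lt_of_le_of_lt hle ENNReal.ofReal_lt_top⟩
  refine ⟨hint, ?_⟩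
  have h0 : 0 ≤ ∫ z in Ioi (0 : ℝ), n z * |f z| :=
    setIntegral_nonneg measurableSet_Ioi fun z hz => mul_nonneg (hn z hz) (abs_nonneg _)
  rw [← integral_weight]
  have h1 : ∫ x, |kernelFun K f x| ∂(weightMeasure k) =
      (∫⁻ x, ‖kernelFun K f x‖ₑ ∂(weightMeasure k)).toReal :=
    integral_norm_eq_lintegral_enorm hmeas'
  rw [h1]
  exact ENNReal.toReal_le_of_le_ofReal h0 hle

/-- The columns have a kink or jump at `x = z`. Up to there a constant bound costs `α z`; beyond, `∫
e^{-(x-z)/2} dx = 2` gives `2 β`. -/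
theorem lintegral_enorm_le_of_exp_decay {k z α β : ℝ} (hz : 0 < z) (hβ : 0 ≤ β)
    {F : ℝ → ℝ} (hF : Measurable F) (h1 : ∀ x, 0 < x → x ≤ z → (1 + x) ^ k * |F x| ≤ α)
    (h2 : ∀ x, z < x → (1 + x) ^ k * |F x| ≤ β * Real.exp (-(1 / 2) * (x - z))) :
    ∫⁻ x, ‖F x‖ₑ ∂(weightMeasure k) ≤ ENNReal.ofReal (α * z + 2 * β) := by
  have hα : 0 ≤ α := le_trans (by positivity) (h1 z hz le_rfl)
  rw [lintegral_weight k hF.enorm.aemeasurable, ← Ioc_union_Ioi_eq_Ioi hz.le,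
    lintegral_union measurableSet_Ioi (Ioc_disjoint_Ioi le_rfl),
    ENNReal.ofReal_add (by positivity) (by positivity)]
  have e : ∀ x, 0 < x → ENNReal.ofReal ((1 + x) ^ k) * ‖F x‖ₑ =
      ENNReal.ofReal ((1 + x) ^ k * |F x|) := fun x hx => by
    rw [ENNReal.ofReal_mul (by positivity), Real.enorm_eq_ofReal_abs]
  gcongr
  · calc ∫⁻ x in Ioc 0 z, ENNReal.ofReal ((1 + x) ^ k) * ‖F x‖ₑ
        ≤ ∫⁻ _ in Ioc 0 z, ENNReal.ofReal α := by
          refine setLIntegral_mono' measurableSet_Ioc fun x hx => ?_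
          rw [e x hx.1]
          exact ENNReal.ofReal_le_ofReal (h1 x hx.1 hx.2)
      _ = ENNReal.ofReal (α * z) := by
          rw [setLIntegral_const, Real.volume_Ioc, sub_zero, ENNReal.ofReal_mul hα]
  · have hi : IntegrableOn (fun x => β * Real.exp (-(1 / 2) * (x - z))) (Ioi z) := by
      have := (integrableOn_exp_mul_Ioi (a := -(1 / 2)) (by norm_num) z).const_mul
        (β * Real.exp (1 / 2 * z))
      refine this.congr (Eventually.of_forall fun x => ?_)
      simp only
      rw [mul_assoc, ← Real.exp_add]
      congr 2
      ring
    calc ∫⁻ x in Ioi z, ENNReal.ofReal ((1 + x) ^ k) * ‖F x‖ₑ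
        ≤ ∫⁻ x in Ioi z, ENNReal.ofReal (β * Real.exp (-(1 / 2) * (x - z))) := by
          refine setLIntegral_mono' measurableSet_Ioi fun x hx => ?_
          rw [e x (hz.trans hx)]
          exact ENNReal.ofReal_le_ofReal (h2 x hx)
      _ = ENNReal.ofReal (2 * β) := by
          rw [← ofReal_integral_eq_lintegral_ofReal hi
            (Eventually.of_forall fun x => by positivity), integral_const_mul]
          congr 1
          have : ∀ x, Real.exp (-(1 / 2) * (x - z)) =
              Real.exp (1 / 2 * z) * Real.exp (-(1 / 2) * x) := fun x => by
            rw [← Real.exp_add]; congr 1; ring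
          simp_rw [this]
          rw [integral_const_mul, integral_exp_mul_Ioi (by norm_num)]
          have h3 : Real.exp (1 / 2 * z) * Real.exp (-(1 / 2) * z) = 1 := by
            rw [← Real.exp_add]; simp
          linear_combination (2 * β) * h3

/-! ### The kernels of `h ↦ G₀ ∗ h - G₀ ∫ h` and of its square -/

/-- The kernel of `h ↦ G₀ ∗ h - G₀ ∫ h`. -/
noncomputable def convKernel (x z : ℝ) : ℝ :=
  Real.exp (-x) * ((if z < x then Real.exp z else 0) - 1)

/-- The kernel of `h ↦ Q ∗ h - Q ∫ h + Q' ∫ z h` with `Q(x) = x e^{-x}`. -/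
noncomputable def convSqKernel (x z : ℝ) : ℝ :=
  Real.exp (-x) * ((if z < x then (x - z) * Real.exp z else 0) - x + z * (1 - x))

theorem measurable_convKernel : Measurable (Function.uncurry convKernel) := by
  unfold Function.uncurry convKernel
  refine Measurable.mul (by fun_prop) (Measurable.sub ?_ (by fun_prop))
  exact Measurable.ite (measurableSet_lt measurable_snd measurable_fst) (by fun_prop) (by fun_prop)

theorem measurable_convSqKernel : Measurable (Function.uncurry convSqKernel) := by
  unfold Function.uncurry convSqKernel
  refine Measurable.mul (by fun_prop) (Measurable.add (Measurable.sub ?_ (by fun_prop))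
    (by fun_prop))
  exact Measurable.ite (measurableSet_lt measurable_snd measurable_fst) (by fun_prop) (by fun_prop)

/-! ### Weighted norms of the kernel columns -/

theorem exists_rpow_le_exp (p : ℝ) :
    ∃ M : ℝ, 0 < M ∧ ∀ x : ℝ, 0 ≤ x → (1 + x) ^ p ≤ M * Real.exp (1 / 2 * x) := by
  obtain ⟨n, hn⟩ := exists_nat_ge p
  refine ⟨2 ^ n * (n.factorial : ℝ) * Real.exp (1 / 2), by positivity, fun x hx => ?_⟩
  have h1 := Real.pow_div_factorial_le_exp (x := 1 / 2 * (1 + x)) (by positivity) n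
  rw [div_le_iff₀ (by positivity), mul_pow] at h1
  calc (1 + x) ^ p ≤ (1 + x) ^ (n : ℝ) := Real.rpow_le_rpow_of_exponent_le (by linarith) hn
    _ = 2 ^ n * ((1 / 2) ^ n * (1 + x) ^ n) := by
        rw [Real.rpow_natCast, ← mul_assoc, ← mul_pow]; norm_num
    _ ≤ 2 ^ n * (Real.exp (1 / 2 * (1 + x)) * n.factorial) := by gcongr
    _ = _ := by
        rw [mul_add, Real.exp_add, mul_one]; ring

theorem one_sub_exp_neg_mul_le {z : ℝ} (hz : 0 < z) :
    (1 - Real.exp (-z)) * (1 + z) ≤ 2 * z := by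
  have h1 := Real.add_one_le_exp (-z)
  have h2 := Real.exp_pos (-z)
  rcases le_total z 1 with h | h
  · nlinarith
  · nlinarith

/-- For `z ≤ 1`, `e^{-z} ≥ 1 - z` bounds the first factor by `z²` and the second is at most `4`; for
`z ≥ 1` the first is at most `1` and `1 + z ≤ 2z`. -/
theorem one_sub_one_add_mul_exp_neg_mul_le {z : ℝ} (hz : 0 < z) :
    (1 - (1 + z) * Real.exp (-z)) * (1 + z) ^ 2 ≤ 4 * z ^ 2 := by
  have h1 := Real.add_one_le_exp (-z)
  have h2 := Real.exp_pos (-z)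
  rcases le_total z 1 with h | h
  · have h3 : 1 - (1 + z) * Real.exp (-z) ≤ z ^ 2 := by nlinarith
    have h4 : (1 + z) ^ 2 ≤ 4 := by nlinarith
    have h5 : 0 ≤ (1 + z) ^ 2 := by positivity
    nlinarith [sq_nonneg z]
  · have h3 : 1 - (1 + z) * Real.exp (-z) ≤ 1 := by nlinarith
    have h4 : (1 + z) ^ 2 ≤ 4 * z ^ 2 := by nlinarith
    nlinarith [sq_nonneg (1 + z)]

theorem one_sub_one_add_mul_exp_neg_nonneg (z : ℝ) :
    0 ≤ 1 - (1 + z) * Real.exp (-z) := by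
  have h1 := Real.add_one_le_exp z
  have h2 : Real.exp z * Real.exp (-z) = 1 := by rw [← Real.exp_add]; simp
  nlinarith [Real.exp_pos (-z)]

section KernelBounds

variable {k M : ℝ}

/-- Half of the exponential pays for the polynomial weight, the other half stays integrable. -/
theorem rpow_mul_exp_neg_le (hM : ∀ x : ℝ, 0 ≤ x → (1 + x) ^ (k + 1) ≤ M * Real.exp (1 / 2 * x))
    {x : ℝ} (hx : 0 ≤ x) : (1 + x) ^ (k + 1) * Real.exp (-x) ≤ M * Real.exp (-(1 / 2) * x) := by
  calc _ ≤ M * Real.exp (1 / 2 * x) * Real.exp (-x) := by gcongr; exact hM x hx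
    _ = _ := by rw [mul_assoc, ← Real.exp_add]; ring_nf

theorem weight_mul_exp_neg_le (hM : ∀ x : ℝ, 0 ≤ x → (1 + x) ^ (k + 1) ≤ M * Real.exp (1 / 2 * x))
    {x : ℝ} (hx : 0 ≤ x) : (1 + x) ^ k * Real.exp (-x) ≤ M * Real.exp (-(1 / 2) * x) := by
  refine le_trans ?_ (rpow_mul_exp_neg_le hM hx)
  gcongr
  · linarith
  · linarith

theorem weight_le_mul (hk : 0 ≤ k) {x z : ℝ} (hz : 0 ≤ z) (hx : z ≤ x) :
    (1 + x) ^ k ≤ (1 + z) ^ k * (1 + (x - z)) ^ k := by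
  rw [← Real.mul_rpow (by positivity) (by linarith)]
  refine Real.rpow_le_rpow (by linarith) ?_ hk
  nlinarith

/-- Left of `z` the column is `-e^{-x}`, contributing `M z`. Right of `z` it is `(1 - e^{-z})
e^{-(x-z)}`, and `(1 - e^{-z})(1+z) ≤ 2z` yields the remaining `4` of the constant `5`. -/
theorem lintegral_convKernel_le (hk : 1 ≤ k) (hM0 : 0 ≤ M)
    (hM : ∀ x : ℝ, 0 ≤ x → (1 + x) ^ (k + 1) ≤ M * Real.exp (1 / 2 * x)) {z : ℝ} (hz : 0 < z) :
    ∫⁻ x, ‖convKernel x z‖ₑ ∂(weightMeasure k) ≤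
      ENNReal.ofReal (5 * M * (z ^ 1 * (1 + z) ^ (k - 1))) := by
  have hez : 0 ≤ 1 - Real.exp (-z) := by
    have : Real.exp (-z) ≤ 1 := Real.exp_le_one_iff.2 (by linarith)
    linarith
  have hF : Measurable fun x => convKernel x z :=
    measurable_convKernel.comp (measurable_id.prodMk measurable_const)
  refine (lintegral_enorm_le_of_exp_decay (α := M) (β := (1 - Real.exp (-z)) * (1 + z) ^ k * M)
    hz (by positivity) hF ?_ ?_).trans (ENNReal.ofReal_le_ofReal ?_)
  · intro x hx hxz
    rw [convKernel, if_neg (not_lt.2 hxz), zero_sub, mul_neg_one, abs_neg, Real.abs_exp]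
    refine (weight_mul_exp_neg_le hM hx.le).trans (mul_le_of_le_one_right hM0 ?_)
    exact Real.exp_le_one_iff.2 (by linarith)
  · intro x hx
    have hx0 : 0 < x := hz.trans hx
    have e1 : convKernel x z = Real.exp (-(x - z)) * (1 - Real.exp (-z)) := by
      have h1 : Real.exp (-(x - z)) = Real.exp (-x) * Real.exp z := by
        rw [← Real.exp_add]; congr 1; ring
      have h2 : Real.exp z * Real.exp (-z) = 1 := by rw [← Real.exp_add]; simp
      rw [convKernel, if_pos hx, h1]
      linear_combination Real.exp (-x) * h2
    rw [e1, abs_of_nonneg (by positivity)]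
    have h3 := weight_mul_exp_neg_le hM (x := x - z) (by linarith)
    calc (1 + x) ^ k * (Real.exp (-(x - z)) * (1 - Real.exp (-z)))
        ≤ ((1 + z) ^ k * (1 + (x - z)) ^ k) * (Real.exp (-(x - z)) * (1 - Real.exp (-z))) := by
          gcongr
          exact weight_le_mul (by linarith) hz.le hx.le
      _ = (1 - Real.exp (-z)) * (1 + z) ^ k * ((1 + (x - z)) ^ k * Real.exp (-(x - z))) := by ring
      _ ≤ (1 - Real.exp (-z)) * (1 + z) ^ k * (M * Real.exp (-(1 / 2) * (x - z))) := by gcongr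
      _ = _ := by ring
  · have h1 : (1 + z) ^ k = (1 + z) * (1 + z) ^ (k - 1) := by
      rw [Real.rpow_sub_one (by positivity)]; field_simp
    have h2 : 1 ≤ (1 + z) ^ (k - 1) := one_le_weight (by linarith) hz.le
    have h3 := one_sub_exp_neg_mul_le hz
    rw [h1, pow_one]
    have h4 : M * z ≤ M * z * (1 + z) ^ (k - 1) := le_mul_of_one_le_right (by positivity) h2
    have h5 : M * (1 + z) ^ (k - 1) * ((1 - Real.exp (-z)) * (1 + z)) ≤
        M * (1 + z) ^ (k - 1) * (2 * z) := by gcongr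
    nlinarith

/-- The column is the second-order Taylor remainder of `Q(x) = x e^{-x}`, where `Q(x-z)` is cut off
at `z = x`. Left of `z` the bound `z M` on an interval of length `z` contributes `1`; right of it
the two terms contribute `2·4` and `2·1`, in total `11`. -/
theorem lintegral_convSqKernel_le (hk : 2 ≤ k) (hM0 : 0 ≤ M)
    (hM : ∀ x : ℝ, 0 ≤ x → (1 + x) ^ (k + 1) ≤ M * Real.exp (1 / 2 * x)) {z : ℝ} (hz : 0 < z) :
    ∫⁻ x, ‖convSqKernel x z‖ₑ ∂(weightMeasure k) ≤
      ENNReal.ofReal (11 * M * (z ^ 2 * (1 + z) ^ (k - 2))) := by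
  have hez := one_sub_one_add_mul_exp_neg_nonneg z
  have hF : Measurable fun x => convSqKernel x z :=
    measurable_convSqKernel.comp (measurable_id.prodMk measurable_const)
  refine (lintegral_enorm_le_of_exp_decay (α := z * M)
    (β := (1 - (1 + z) * Real.exp (-z)) * (1 + z) ^ k * M + z ^ 2 * M)
    hz (by positivity) hF ?_ ?_).trans (ENNReal.ofReal_le_ofReal ?_)
  · intro x hx hxz
    rw [convSqKernel, if_neg (not_lt.2 hxz), abs_mul, Real.abs_exp]
    have h1 : |0 - x + z * (1 - x)| ≤ z * (1 + x) := by
      rw [abs_le]; constructor <;> nlinarith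
    have h2 : (1 + x) ^ (k + 1) = (1 + x) ^ k * (1 + x) := Real.rpow_add_one (by positivity) k
    calc (1 + x) ^ k * (Real.exp (-x) * |0 - x + z * (1 - x)|)
        ≤ (1 + x) ^ k * (Real.exp (-x) * (z * (1 + x))) := by gcongr
      _ = z * ((1 + x) ^ (k + 1) * Real.exp (-x)) := by rw [h2]; ring
      _ ≤ z * (M * Real.exp (-(1 / 2) * x)) := by
          exact mul_le_mul_of_nonneg_left (rpow_mul_exp_neg_le hM hx.le) hz.le
      _ ≤ z * (M * 1) := by
          gcongr
          exact Real.exp_le_one_iff.2 (by linarith)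
      _ = z * M := by ring
  · intro x hx
    have hx0 : 0 < x := hz.trans hx
    have hu : 0 < x - z := by linarith
    -- With `u = x - z`, this exhibits two terms of order `z²`, one decaying in `u` and one in `x`.
    have e1 : convSqKernel x z = (1 - (1 + z) * Real.exp (-z)) *
        ((x - z) * Real.exp (-(x - z))) - z ^ 2 * Real.exp (-x) := by
      have h1 : Real.exp (-(x - z)) = Real.exp (-x) * Real.exp z := by
        rw [← Real.exp_add]; congr 1; ring
      have h2 : Real.exp z * Real.exp (-z) = 1 := by rw [← Real.exp_add]; simp
      rw [convSqKernel, if_pos hx, h1]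
      linear_combination (1 + z) * (x - z) * Real.exp (-x) * h2
    have h3 : |convSqKernel x z| ≤ (1 - (1 + z) * Real.exp (-z)) *
        ((x - z) * Real.exp (-(x - z))) + z ^ 2 * Real.exp (-x) := by
      rw [e1, abs_le]
      have p1 : 0 ≤ (1 - (1 + z) * Real.exp (-z)) * ((x - z) * Real.exp (-(x - z))) := by
        positivity
      have p2 : 0 ≤ z ^ 2 * Real.exp (-x) := by positivity
      constructor <;> linarith
    have h4 := rpow_mul_exp_neg_le hM (x := x - z) hu.le
    have h5 := weight_mul_exp_neg_le hM (x := x) hx0.le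
    have h6 : Real.exp (-(1 / 2) * x) ≤ Real.exp (-(1 / 2) * (x - z)) :=
      Real.exp_le_exp.2 (by linarith)
    have h7 : (1 + (x - z)) ^ k * (x - z) ≤ (1 + (x - z)) ^ (k + 1) := by
      rw [Real.rpow_add_one (by positivity)]
      gcongr
      linarith
    calc (1 + x) ^ k * |convSqKernel x z|
        ≤ (1 + x) ^ k * ((1 - (1 + z) * Real.exp (-z)) *
          ((x - z) * Real.exp (-(x - z))) + z ^ 2 * Real.exp (-x)) := by gcongr
      _ = (1 + x) ^ k * ((1 - (1 + z) * Real.exp (-z)) * ((x - z) * Real.exp (-(x - z)))) +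
          z ^ 2 * ((1 + x) ^ k * Real.exp (-x)) := by ring
      _ ≤ ((1 + z) ^ k * (1 + (x - z)) ^ k) *
            ((1 - (1 + z) * Real.exp (-z)) * ((x - z) * Real.exp (-(x - z)))) +
          z ^ 2 * (M * Real.exp (-(1 / 2) * x)) := by
          gcongr
          exact weight_le_mul (by linarith) hz.le hx.le
      _ = (1 - (1 + z) * Real.exp (-z)) * (1 + z) ^ k *
            ((1 + (x - z)) ^ k * (x - z) * Real.exp (-(x - z))) +
          z ^ 2 * (M * Real.exp (-(1 / 2) * x)) := by ring
      _ ≤ (1 - (1 + z) * Real.exp (-z)) * (1 + z) ^ k * (M * Real.exp (-(1 / 2) * (x - z))) +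
          z ^ 2 * (M * Real.exp (-(1 / 2) * (x - z))) := by
          refine add_le_add (mul_le_mul_of_nonneg_left (le_trans ?_ h4) (by positivity))
            (by gcongr)
          gcongr
      _ = _ := by ring
  · have h1 : (1 + z) ^ k = (1 + z) ^ 2 * (1 + z) ^ (k - 2) := by
      rw [← Real.rpow_natCast, ← Real.rpow_add (by positivity)]
      congr 1
      push_cast
      ring
    have h2 : 1 ≤ (1 + z) ^ (k - 2) := one_le_weight (by linarith) hz.le
    have h3 := one_sub_one_add_mul_exp_neg_mul_le hz
    rw [h1]
    have h4 : M * z ^ 2 ≤ M * z ^ 2 * (1 + z) ^ (k - 2) :=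
      le_mul_of_one_le_right (by positivity) h2
    have h5 : M * (1 + z) ^ (k - 2) * ((1 - (1 + z) * Real.exp (-z)) * (1 + z) ^ 2) ≤
        M * (1 + z) ^ (k - 2) * (4 * z ^ 2) := by gcongr
    nlinarith

end KernelBounds

/-! ### Vanishing weights under dilation -/

theorem pow_mul_rpow_sub_le_weight {k : ℝ} {j : ℕ} {x : ℝ} (hx : 0 < x) :
    x ^ j * (1 + x) ^ (k - j) ≤ (1 + x) ^ k := by
  have h1 : (1 + x) ^ k = (1 + x) ^ j * (1 + x) ^ (k - j) := by
    rw [← Real.rpow_natCast, ← Real.rpow_add (by positivity)]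
    congr 1
    ring
  rw [h1]
  gcongr
  linarith

theorem integrableOn_pow_mul_rpow {k : ℝ} (j : ℕ) {f : ℝ → ℝ}
    (hf : Integrable f (weightMeasure k)) :
    IntegrableOn (fun x => x ^ j * (1 + x) ^ (k - j) * |f x|) (Ioi 0) :=
  integrableOn_mul_of_weight hf.abs (by fun_prop) fun x hx => by
    rw [abs_of_nonneg (by positivity)]
    exact pow_mul_rpow_sub_le_weight hx

/-- The Jacobian gives one factor `c⁻¹` and the weight `x^j` gives `j` more: order of vanishing at
the origin becomes rate of decay. -/
theorem integral_pow_mul_rpow_dilation_le {k : ℝ} {j : ℕ} (hj : (j : ℝ) ≤ k) {c : ℝ} (hc : 1 ≤ c)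
    {f : ℝ → ℝ} (hf : Integrable f (weightMeasure k)) :
    ∫ x in Ioi (0 : ℝ), x ^ j * (1 + x) ^ (k - j) * |f (c * x)| ≤
      c⁻¹ ^ (j + 1) * ∫ x in Ioi (0 : ℝ), |f x| * (1 + x) ^ k := by
  have hc0 : 0 < c := by linarith
  have h2 := integral_comp_mul_left_Ioi
    (fun x => (c⁻¹ * x) ^ j * (1 + c⁻¹ * x) ^ (k - j) * |f x|) 0 hc0
  simp only [inv_mul_cancel_left₀ hc0.ne', mul_zero, smul_eq_mul] at h2
  rw [h2, pow_succ', mul_assoc, ← integral_const_mul (c⁻¹ ^ j)]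
  refine mul_le_mul_of_nonneg_left ?_ (by positivity)
  have hb : ∀ x, 0 < x → (c⁻¹ * x) ^ j * (1 + c⁻¹ * x) ^ (k - j) ≤ c⁻¹ ^ j * (1 + x) ^ k := by
    intro x hx
    have hcl : c⁻¹ ≤ 1 := inv_le_one_of_one_le₀ hc
    rw [mul_pow, mul_assoc]
    gcongr
    refine le_trans ?_ (pow_mul_rpow_sub_le_weight (k := k) (j := j) hx)
    have hcx : c⁻¹ * x ≤ x := mul_le_of_le_one_left hx.le hcl
    gcongr
  have hI := integrable_weight_iff.1 hf.abs
  refine setIntegral_mono_on ?_ (hI.const_mul _) measurableSet_Ioi fun x hx => ?_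
  · refine Integrable.mono (hI.const_mul (c⁻¹ ^ j)) ?_ ?_
    · exact AEStronglyMeasurable.mul (by fun_prop)
        (aestronglyMeasurable_weight_iff.1 hf.abs.aestronglyMeasurable)
    · filter_upwards [ae_restrict_mem measurableSet_Ioi] with x hx
      have hx0 : (0 : ℝ) < x := hx
      rw [Real.norm_of_nonneg (by positivity), Real.norm_of_nonneg (by positivity)]
      calc _ ≤ c⁻¹ ^ j * (1 + x) ^ k * |f x| := mul_le_mul_of_nonneg_right (hb x hx0) (abs_nonneg _)
        _ = _ := by ring
  · calc _ ≤ c⁻¹ ^ j * (1 + x) ^ k * |f x| := mul_le_mul_of_nonneg_right (hb x hx) (abs_nonneg _)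
      _ = _ := by ring

end Coagulation

namespace Coagulation

/-! ### The first moment as a functional -/

theorem firstMoment_congr {f g : ℝ → ℝ} (h : f =ᵐ[volume.restrict (Ioi (0 : ℝ))] g) :
    firstMoment f = firstMoment g := by
  refine integral_congr_ae ?_
  filter_upwards [h] with x hx
  rw [hx]

theorem firstMoment_toL1 {k : ℝ} {f : ℝ → ℝ} (hf : Integrable f (weightMeasure k)) :
    firstMoment (hf.toL1 f) = firstMoment f :=
  firstMoment_congr (coeFn_toL1_weight hf)

/-- The first moment as a continuous linear functional. -/
noncomputable def momentCLM {k : ℝ} (hk : 1 ≤ k) : L1w k →L[ℝ] ℝ :=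
  LinearMap.mkContinuous
    { toFun := fun h => firstMoment h
      map_add' := fun f g => by
        rw [firstMoment_congr (ae_weight_iff.1 (Lp.coeFn_add f g))]
        simp only [firstMoment, Pi.add_apply, mul_add]
        exact integral_add (integrableOn_id_mul_of_weight hk (integrable_coe f))
          (integrableOn_id_mul_of_weight hk (integrable_coe g))
      map_smul' := fun c f => by
        rw [firstMoment_congr (ae_weight_iff.1 (Lp.coeFn_smul c f))]
        simp only [firstMoment, Pi.smul_apply, smul_eq_mul, RingHom.id_apply]
        rw [← integral_const_mul]
        congr 1
        ext x
        ring }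
    1 fun h => by
      rw [one_mul, norm_eq_integral_weight]
      refine norm_integral_le_of_norm_le (integrable_weight_iff.1 (integrable_coe h).abs) ?_
      filter_upwards [ae_restrict_mem measurableSet_Ioi] with x hx
      have hx0 : (0 : ℝ) < x := hx
      rw [norm_mul, Real.norm_eq_abs, Real.norm_eq_abs, abs_of_pos hx0, mul_comm]
      exact mul_le_mul_of_nonneg_left (le_weight hk hx0.le) (abs_nonneg _)

@[simp] theorem momentCLM_apply {k : ℝ} (hk : 1 ≤ k) (h : L1w k) :
    momentCLM hk h = firstMoment h := rfl

/-! ### The operator `h ↦ G₀ ∗ h - G₀ ∫ h` -/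

/-- A constant with `(1+x)^(k+1) ≤ M e^{x/2}` for `x ≥ 0`. -/
noncomputable def expConst (k : ℝ) : ℝ := (exists_rpow_le_exp (k + 1)).choose

theorem expConst_pos (k : ℝ) : 0 < expConst k := (exists_rpow_le_exp (k + 1)).choose_spec.1

theorem rpow_le_expConst (k : ℝ) :
    ∀ x : ℝ, 0 ≤ x → (1 + x) ^ (k + 1) ≤ expConst k * Real.exp (1 / 2 * x) :=
  (exists_rpow_le_exp (k + 1)).choose_spec.2

theorem convKernel_bound {k : ℝ} (hk : 1 ≤ k) {f : ℝ → ℝ} (hf : Integrable f (weightMeasure k)) :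
    Integrable (kernelFun convKernel f) (weightMeasure k) ∧
      ∫ x in Ioi (0 : ℝ), |kernelFun convKernel f x| * (1 + x) ^ k ≤
        5 * expConst k * ∫ x in Ioi (0 : ℝ), x ^ 1 * (1 + x) ^ (k - 1) * |f x| := by
  have hM := expConst_pos k
  have hi := integrableOn_pow_mul_rpow 1 hf
  rw [Nat.cast_one] at hi
  have := kernel_bound measurable_convKernel
    (n := fun z => 5 * expConst k * (z ^ 1 * (1 + z) ^ (k - 1)))
    (fun z hz => by positivity)
    (fun z hz => lintegral_convKernel_le hk hM.le (rpow_le_expConst k) hz)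
    (aestronglyMeasurable_weight_iff.1 hf.aestronglyMeasurable)
    (by simpa only [mul_assoc, IntegrableOn] using hi.const_mul (5 * expConst k))
  refine ⟨this.1, this.2.trans_eq ?_⟩
  rw [← integral_const_mul]
  simp only [mul_assoc]

theorem convSqKernel_bound {k : ℝ} (hk : 2 ≤ k) {f : ℝ → ℝ}
    (hf : Integrable f (weightMeasure k)) :
    Integrable (kernelFun convSqKernel f) (weightMeasure k) ∧
      ∫ x in Ioi (0 : ℝ), |kernelFun convSqKernel f x| * (1 + x) ^ k ≤
        11 * expConst k * ∫ x in Ioi (0 : ℝ), x ^ 2 * (1 + x) ^ (k - 2) * |f x| := by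
  have hM := expConst_pos k
  have hi := integrableOn_pow_mul_rpow 2 hf
  rw [Nat.cast_ofNat] at hi
  have := kernel_bound measurable_convSqKernel
    (n := fun z => 11 * expConst k * (z ^ 2 * (1 + z) ^ (k - 2)))
    (fun z hz => by positivity)
    (fun z hz => lintegral_convSqKernel_le hk hM.le (rpow_le_expConst k) hz)
    (aestronglyMeasurable_weight_iff.1 hf.aestronglyMeasurable)
    (by simpa only [mul_assoc, IntegrableOn] using hi.const_mul (11 * expConst k))
  refine ⟨this.1, this.2.trans_eq ?_⟩
  rw [← integral_const_mul]
  simp only [mul_assoc]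

theorem abs_convKernel_le {x z : ℝ} (hx : 0 < x) (hz : 0 < z) : |convKernel x z| ≤ 1 := by
  have h1 : Real.exp (-x) ≤ 1 := Real.exp_le_one_iff.2 (by linarith)
  have h2 := Real.exp_pos (-x)
  have h0 : Real.exp (-x) * Real.exp x = 1 := by rw [← Real.exp_add]; simp
  unfold convKernel
  split_ifs with h
  · have h3 : 1 ≤ Real.exp z := Real.one_le_exp hz.le
    have h4 : Real.exp z ≤ Real.exp x := Real.exp_le_exp.2 h.le
    rw [abs_le]
    constructor <;> nlinarith
  · rw [abs_le]
    constructor <;> nlinarith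

theorem integrableOn_convKernel_mul {f : ℝ → ℝ} (hf : IntegrableOn f (Ioi 0)) {x : ℝ}
    (hx : 0 < x) : IntegrableOn (fun z => convKernel x z * f z) (Ioi 0) := by
  refine Integrable.mono hf ?_ ?_
  · exact (measurable_convKernel.comp (measurable_const.prodMk measurable_id)
      ).aestronglyMeasurable.mul hf.aestronglyMeasurable
  · filter_upwards [ae_restrict_mem measurableSet_Ioi] with z hz
    rw [norm_mul]
    exact mul_le_of_le_one_left (norm_nonneg _) (abs_convKernel_le hx hz)

/-- The operator `h ↦ G₀ ∗ h - G₀ ∫ h` on `L¹((1+x)^k)`. -/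
noncomputable def convOp {k : ℝ} (hk : 1 ≤ k) : L1w k →L[ℝ] L1w k :=
  LinearMap.mkContinuous
    { toFun := fun h => (convKernel_bound hk (integrable_coe h)).1.toL1 (kernelFun convKernel h)
      map_add' := fun f g => by
        rw [toL1_eq_iff_weight]
        filter_upwards [ae_weight_iff.1 (Lp.coeFn_add
          ((convKernel_bound hk (integrable_coe f)).1.toL1 (kernelFun convKernel f))
          ((convKernel_bound hk (integrable_coe g)).1.toL1 (kernelFun convKernel g))),
          coeFn_toL1_weight (convKernel_bound hk (integrable_coe f)).1,
          coeFn_toL1_weight (convKernel_bound hk (integrable_coe g)).1,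
          ae_restrict_mem measurableSet_Ioi] with x e1 e2 e3 hx
        rw [e1, Pi.add_apply, e2, e3, kernelFun_congr (ae_weight_iff.1 (Lp.coeFn_add f g))]
        simp only [kernelFun, Pi.add_apply, mul_add]
        exact integral_add
          (integrableOn_convKernel_mul (integrableOn_of_weight (by linarith) (integrable_coe f)) hx)
          (integrableOn_convKernel_mul (integrableOn_of_weight (by linarith) (integrable_coe g)) hx)
      map_smul' := fun c f => by
        rw [toL1_eq_iff_weight]
        filter_upwards [ae_weight_iff.1 (Lp.coeFn_smul c
          ((convKernel_bound hk (integrable_coe f)).1.toL1 (kernelFun convKernel f))),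
          coeFn_toL1_weight (convKernel_bound hk (integrable_coe f)).1] with x e1 e2
        rw [RingHom.id_apply, e1, Pi.smul_apply, e2,
          kernelFun_congr (ae_weight_iff.1 (Lp.coeFn_smul c f))]
        simp only [kernelFun, Pi.smul_apply, smul_eq_mul]
        rw [← integral_const_mul]
        congr 1
        ext z
        ring }
    (5 * expConst k) fun h => by
      simp only [LinearMap.coe_mk, AddHom.coe_mk]
      rw [norm_toL1_weight, norm_eq_integral_weight]
      refine (convKernel_bound hk (integrable_coe h)).2.trans ?_
      refine mul_le_mul_of_nonneg_left ?_ (by have := expConst_pos k; positivity)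
      -- The case `c = 1` merely compares `x (1+x)^(k-1)` with the full weight.
      have := integral_pow_mul_rpow_dilation_le (j := 1) (by simpa using hk) le_rfl
        (integrable_coe h)
      simpa using this

theorem convOp_toL1 {k : ℝ} (hk : 1 ≤ k) {f : ℝ → ℝ} (hf : Integrable f (weightMeasure k)) :
    convOp hk (hf.toL1 f) = (convKernel_bound hk hf).1.toL1 (kernelFun convKernel f) := by
  symm
  rw [toL1_eq_iff_weight]
  refine EventuallyEq.trans ?_
    (coeFn_toL1_weight (convKernel_bound hk (integrable_coe (hf.toL1 f))).1).symm
  rw [kernelFun_congr (coeFn_toL1_weight hf)]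

/-- `convOp ∘ dilation` decays twice as fast as `dilation`. -/
theorem norm_convOp_dilation_le {k : ℝ} (hk : 1 ≤ k) (t : ℝ≥0) (h : L1w k) :
    ‖convOp hk (dilation (zero_le_one.trans hk) t h)‖ ≤
      5 * expConst k * Real.exp (-t) ^ 2 * ‖h‖ := by
  have hi := integrable_comp_mul_left (zero_le_one.trans hk) (one_le_exp_coe t) (integrable_coe h)
  have e : dilation (zero_le_one.trans hk) t h = hi.toL1 _ := rfl
  rw [e, convOp_toL1, norm_toL1_weight, norm_eq_integral_weight]
  refine (convKernel_bound hk hi).2.trans ?_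
  rw [mul_assoc (5 * expConst k)]
  refine mul_le_mul_of_nonneg_left ?_ (by have := expConst_pos k; positivity)
  have := integral_pow_mul_rpow_dilation_le (j := 1) (by simpa using hk) (one_le_exp_coe t)
    (integrable_coe h)
  rw [Nat.cast_one, ← Real.exp_neg] at this
  exact this

/-! ### `convOp` through the equation `y' + y = f`, `y(0) = -∫ f` -/

theorem kernelFun_convKernel {f : ℝ → ℝ} (hf : IntegrableOn f (Ioi 0)) (hfc : Continuous f)
    {x : ℝ} (hx : 0 < x) : kernelFun convKernel f x =
      Real.exp (-x) * ((∫ z in (0 : ℝ)..x, Real.exp z * f z) - ∫ z in Ioi (0 : ℝ), f z) := by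
  have hi : IntegrableOn (fun z => Real.exp z * f z) (Ioo 0 x) :=
    ((Real.continuous_exp.mul hfc).integrableOn_Icc).mono_set Ioo_subset_Icc_self
  have e : ∀ z ∈ Ioi (0 : ℝ), convKernel x z * f z =
      Real.exp (-x) * ((Ioo 0 x).indicator (fun z => Real.exp z * f z) z - f z) := by
    intro z hz
    have hz0 : (0 : ℝ) < z := hz
    unfold convKernel
    by_cases h : z < x
    · have hzm : z ∈ Ioo 0 x := ⟨hz0, h⟩
      rw [if_pos h, indicator_of_mem hzm]; ring
    · have hzm : z ∉ Ioo 0 x := fun hh => h hh.2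
      rw [if_neg h, indicator_of_notMem hzm]; ring
  rw [kernelFun, setIntegral_congr_fun measurableSet_Ioi e, integral_const_mul, integral_sub ?_ hf,
    setIntegral_indicator measurableSet_Ioo, inter_eq_self_of_subset_right Ioo_subset_Ioi_self,
    intervalIntegral.integral_of_le hx.le, integral_Ioc_eq_integral_Ioo]
  exact ((integrable_indicator_iff measurableSet_Ioo).2 hi).integrableOn

/-- The integrating factor `e^x` shows uniqueness for the initial value problem, so identities for
`convOp` reduce to checking an equation and one initial value. -/
theorem kernelFun_convKernel_eq_of_ode {f y : ℝ → ℝ} (hf : IntegrableOn f (Ioi 0))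
    (hfc : Continuous f) (hy : ∀ x, HasDerivAt y (f x - y x) x)
    (h0 : y 0 = -∫ z in Ioi (0 : ℝ), f z) {x : ℝ} (hx : 0 < x) :
    kernelFun convKernel f x = y x := by
  have h1 : ∀ z, HasDerivAt (fun z => Real.exp z * y z) (Real.exp z * f z) z := fun z => by
    have := (Real.hasDerivAt_exp z).mul (hy z)
    convert! this using 1
    ring
  have h2 := intervalIntegral.integral_eq_sub_of_hasDerivAt (a := 0) (b := x) (fun z _ => h1 z)
    ((Real.continuous_exp.mul hfc).intervalIntegrable 0 x)
  have h3 : Real.exp (-x) * Real.exp x = 1 := by rw [← Real.exp_add]; simp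
  rw [kernelFun_convKernel hf hfc hx, h2, h0, Real.exp_zero]
  linear_combination y x * h3

/-- The solution of `y' + y = f`, `y(0) = -∫ f`. -/
noncomputable def convSol (f : ℝ → ℝ) (x : ℝ) : ℝ :=
  Real.exp (-x) * ((∫ z in (0 : ℝ)..x, Real.exp z * f z) - ∫ z in Ioi (0 : ℝ), f z)

theorem convSol_zero (f : ℝ → ℝ) : convSol f 0 = -∫ z in Ioi (0 : ℝ), f z := by
  simp [convSol]

theorem hasDerivAt_convSol {f : ℝ → ℝ} (hfc : Continuous f) (x : ℝ) :
    HasDerivAt (convSol f) (f x - convSol f x) x := by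
  have hc : Continuous fun z => Real.exp z * f z := Real.continuous_exp.mul hfc
  have h1 : HasDerivAt (fun x => ∫ z in (0 : ℝ)..x, Real.exp z * f z) (Real.exp x * f x) x :=
    intervalIntegral.integral_hasDerivAt_right (hc.intervalIntegrable _ _)
      (hc.stronglyMeasurableAtFilter _ _) hc.continuousAt
  have h2 := ((hasDerivAt_neg x).exp).mul (h1.sub_const (∫ z in Ioi (0 : ℝ), f z))
  have h3 : Real.exp (-x) * Real.exp x = 1 := by rw [← Real.exp_add]; simp
  refine h2.congr_deriv ?_
  simp only [convSol]
  linear_combination f x * h3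

theorem continuous_convSol {f : ℝ → ℝ} (hfc : Continuous f) : Continuous (convSol f) :=
  continuous_iff_continuousAt.2 fun x => (hasDerivAt_convSol hfc x).continuousAt

theorem integrable_of_ode {k : ℝ} (hk : 1 ≤ k) {f y : ℝ → ℝ} (hf : Integrable f (weightMeasure k))
    (hfc : Continuous f) (hy : ∀ x, HasDerivAt y (f x - y x) x)
    (h0 : y 0 = -∫ z in Ioi (0 : ℝ), f z) :
    Integrable y (weightMeasure k) := by
  refine (convKernel_bound hk hf).1.congr (ae_weight_iff.2 ?_)
  filter_upwards [ae_restrict_mem measurableSet_Ioi] with x hx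
  exact kernelFun_convKernel_eq_of_ode (integrableOn_of_weight (by linarith) hf) hfc hy h0 hx

theorem convOp_toL1_of_ode {k : ℝ} (hk : 1 ≤ k) {f y : ℝ → ℝ}
    (hf : Integrable f (weightMeasure k)) (hfc : Continuous f)
    (hy : ∀ x, HasDerivAt y (f x - y x) x) (h0 : y 0 = -∫ z in Ioi (0 : ℝ), f z)
    (hyi : Integrable y (weightMeasure k)) :
    convOp hk (hf.toL1 f) = hyi.toL1 y := by
  rw [convOp_toL1, toL1_eq_iff_weight]
  filter_upwards [ae_restrict_mem measurableSet_Ioi, coeFn_toL1_weight hyi] with x hx e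
  rw [e]
  exact kernelFun_convKernel_eq_of_ode (integrableOn_of_weight (by linarith) hf) hfc hy h0 hx

theorem TestFn.integrable_convSol {k : ℝ} (hk : 1 ≤ k) (φ : TestFn) :
    Integrable (convSol φ) (weightMeasure k) :=
  integrable_of_ode hk (φ.integrable_weight k) φ.continuous
    (hasDerivAt_convSol φ.continuous) (convSol_zero φ)

theorem convOp_testIncl {k : ℝ} (hk : 1 ≤ k) (φ : TestFn) :
    convOp hk (testIncl k φ) = (φ.integrable_convSol hk).toL1 (convSol φ) :=
  convOp_toL1_of_ode hk (φ.integrable_weight k) φ.continuous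
    (hasDerivAt_convSol φ.continuous) (convSol_zero φ) _

theorem TestFn.convSol_eventually (φ : TestFn) :
    ∃ c R : ℝ, ∀ x, R ≤ x → convSol φ x = c * Real.exp (-x) := by
  obtain ⟨R, hR0, hR⟩ := φ.exists_bound
  refine ⟨(∫ z in (0 : ℝ)..R, Real.exp z * φ z) - ∫ z in Ioi (0 : ℝ), φ z, R, fun x hx => ?_⟩
  have hc : Continuous fun y => Real.exp y * φ y := Real.continuous_exp.mul φ.continuous
  have hi : (∫ y in (0 : ℝ)..x, Real.exp y * φ y) = ∫ y in (0 : ℝ)..R, Real.exp y * φ y := by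
    rw [← intervalIntegral.integral_add_adjacent_intervals (hc.intervalIntegrable 0 R)
      (hc.intervalIntegrable R x), add_eq_left]
    rw [intervalIntegral.integral_congr (g := fun _ => (0 : ℝ)), intervalIntegral.integral_zero]
    intro y hy
    rw [uIcc_of_le hx] at hy
    simp only [hR y hy.1, mul_zero]
  rw [convSol, hi, mul_comm]

/-! ### Mass, first moment and dilation identities for `convOp` -/

theorem TestFn.tendsto_convSol (φ : TestFn) : Tendsto (convSol φ) atTop (𝓝 0) := by
  obtain ⟨c, R, h⟩ := φ.convSol_eventually
  have := (Real.tendsto_exp_neg_atTop_nhds_zero).const_mul c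
  rw [mul_zero] at this
  refine this.congr' ?_
  filter_upwards [eventually_ge_atTop R] with x hx using (h x hx).symm

theorem TestFn.tendsto_mul_convSol (φ : TestFn) :
    Tendsto (fun x => x * convSol φ x) atTop (𝓝 0) := by
  obtain ⟨c, R, h⟩ := φ.convSol_eventually
  have := (Real.tendsto_pow_mul_exp_neg_atTop_nhds_zero 1).const_mul c
  rw [mul_zero] at this
  refine this.congr' ?_
  filter_upwards [eventually_ge_atTop R] with x hx
  rw [h x hx]
  ring

/-- Integrating `y' = φ - y` over the half-line gives `-y(0) = ∫ φ - ∫ y`, and `y(0) = -∫ φ`. -/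
theorem TestFn.integral_convSol (φ : TestFn) : ∫ x in Ioi (0 : ℝ), convSol φ x = 0 := by
  have hi := integrableOn_of_weight zero_le_one (φ.integrable_convSol le_rfl)
  have h := integral_Ioi_of_hasDerivAt_of_tendsto' (a := 0)
    (fun x _ => hasDerivAt_convSol φ.continuous x) (φ.integrable.integrableOn.sub hi)
    φ.tendsto_convSol
  rw [integral_sub φ.integrable.integrableOn hi, convSol_zero] at h
  linarith

/-- Integrate `(x y)' = y + x φ - x y`: the boundary terms vanish and so does `∫ y`. -/
theorem TestFn.firstMoment_convSol (φ : TestFn) : firstMoment (convSol φ) = firstMoment φ := by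
  have hi := integrableOn_of_weight zero_le_one (φ.integrable_convSol le_rfl)
  have hi1 := integrableOn_id_mul_of_weight le_rfl (φ.integrable_convSol le_rfl)
  have hi2 := integrableOn_id_mul_of_weight le_rfl (φ.integrable_weight 1)
  have hi3 : IntegrableOn (fun x => x * φ x - x * convSol φ x) (Ioi 0) := hi2.sub hi1
  have h := integral_Ioi_of_hasDerivAt_of_tendsto' (a := 0)
    (f' := fun x => convSol φ x + (x * φ x - x * convSol φ x))
    (fun x _ => ((hasDerivAt_id x).mul (hasDerivAt_convSol φ.continuous x)).congr_deriv (by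
      simp only [id]; ring)) (hi.add hi3)
    φ.tendsto_mul_convSol
  rw [integral_add hi hi3, integral_sub hi2 hi1, φ.integral_convSol] at h
  simp only [id, zero_mul, Pi.mul_apply] at h
  unfold firstMoment
  linarith

theorem clm_ext_testIncl {k : ℝ} {F : Type*} [NormedAddCommGroup F] [NormedSpace ℝ F]
    {A B : L1w k →L[ℝ] F} (h : ∀ φ, A (testIncl k φ) = B (testIncl k φ)) : A = B :=
  DFunLike.coe_injective
    ((dense_range_testIncl k).equalizer A.continuous B.continuous (funext h))

theorem firstMoment_convOp {k : ℝ} (hk : 1 ≤ k) (h : L1w k) :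
    firstMoment (convOp hk h) = firstMoment h := by
  have : (momentCLM hk).comp (convOp hk) = momentCLM hk := by
    refine clm_ext_testIncl fun φ => ?_
    rw [ContinuousLinearMap.comp_apply, convOp_testIncl, momentCLM_apply, momentCLM_apply,
      firstMoment_toL1, testIncl_apply, firstMoment_toL1, φ.firstMoment_convSol]
  exact DFunLike.congr_fun this h

theorem firstMoment_dilation {k : ℝ} (hk : 0 ≤ k) (t : ℝ≥0) (h : L1w k) :
    firstMoment (dilation hk t h) = Real.exp (-t) ^ 2 * firstMoment h := by
  have e : firstMoment (dilation hk t h) = firstMoment fun x => h (Real.exp t * x) :=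
    firstMoment_congr (coeFn_dilation hk t h)
  have h1 := integral_comp_mul_left_Ioi (fun x => x * h x) 0 (Real.exp_pos t)
  simp only [mul_zero, mul_assoc, smul_eq_mul, integral_const_mul] at h1
  rw [e]
  unfold firstMoment
  have h2 := Real.exp_pos t
  rw [Real.exp_neg, pow_two, mul_assoc, ← h1, inv_mul_cancel_left₀ h2.ne']

/-- The intertwining relation between `convOp` and the dilations. -/
theorem convOp_dilation {k : ℝ} (hk : 1 ≤ k) (t : ℝ≥0) (h : L1w k) :
    convOp hk (dilation (zero_le_one.trans hk) t h) =
      Real.exp (-t) • dilation (zero_le_one.trans hk) t (convOp hk h) +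
      (1 - Real.exp (-t)) •
        convOp hk (dilation (zero_le_one.trans hk) t (convOp hk h)) := by
  set hk0 := zero_le_one.trans hk
  have : (convOp hk).comp (dilation hk0 t) = Real.exp (-t) • (dilation hk0 t).comp (convOp hk) +
      (1 - Real.exp (-t)) • (convOp hk).comp ((dilation hk0 t).comp (convOp hk)) := by
    refine clm_ext_testIncl fun φ => ?_
    simp only [ContinuousLinearMap.comp_apply, add_apply,
      smul_apply]
    set F : ℝ → ℝ := fun x => convSol φ (Real.exp t * x) with hF
    have hFc : Continuous F := (continuous_convSol φ.continuous).comp (by fun_prop)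
    have hFi : Integrable F (weightMeasure k) :=
      integrable_comp_mul_left hk0 (one_le_exp_coe t) (φ.integrable_convSol hk)
    have hF0 : ∫ x in Ioi (0 : ℝ), F x = 0 := by
      have := integral_comp_mul_left_Ioi (convSol φ) 0 (Real.exp_pos t)
      rwa [mul_zero, φ.integral_convSol, smul_zero] at this
    have hFd : ∀ x, HasDerivAt F
        ((φ (Real.exp t * x) - convSol φ (Real.exp t * x)) * Real.exp t) x := fun x =>
      HasDerivAt.comp x (hasDerivAt_convSol φ.continuous _)
        (by simpa using (hasDerivAt_id x).const_mul (Real.exp t))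
    have hwi := integrable_of_ode hk hFi hFc (hasDerivAt_convSol hFc) (convSol_zero F)
    have hw := convOp_toL1_of_ode hk hFi hFc (hasDerivAt_convSol hFc) (convSol_zero F) hwi
    have hDφ : dilation hk0 t (testIncl k φ) = ((φ.dil t).integrable_weight k).toL1 (φ.dil t) :=
      dilation_testIncl hk0 t φ
    have hyi := (hFi.const_mul (Real.exp (-t))).add (hwi.const_mul (1 - Real.exp (-t)))
    have hee : Real.exp (-t) * Real.exp t = 1 := by rw [← Real.exp_add]; simp
    -- With `F = D_t A φ` one has `F' = e^t (D_t φ - F)`, so `e^{-t} F + (1 - e^{-t}) A F` solves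
    -- the equation with datum `D_t φ`. The initial values agree because `∫ F = 0` and `∫ D_t φ =
    -- e^{-t} ∫ φ`.
    have hy := convOp_toL1_of_ode hk ((φ.dil t).integrable_weight k) (φ.dil t).continuous
      (y := fun x => Real.exp (-t) * F x + (1 - Real.exp (-t)) * convSol F x)
      (fun x => by
        refine (((hFd x).const_mul _).add ((hasDerivAt_convSol hFc x).const_mul _)).congr_deriv ?_
        rw [TestFn.dil_apply, hF]
        linear_combination (φ (Real.exp t * x) - convSol φ (Real.exp t * x)) * hee)
      (by
        have h1 := integral_comp_mul_left_Ioi φ 0 (Real.exp_pos t)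
        rw [mul_zero, smul_eq_mul, ← Real.exp_neg] at h1
        simp only [TestFn.dil_apply]
        rw [convSol_zero, hF0, h1, hF]
        simp only
        rw [mul_zero, convSol_zero]
        ring) hyi
    rw [hDφ, hy, convOp_testIncl, dilation_toL1, hw]
    rfl
  exact DFunLike.congr_fun this h

/-! ### The square of `convOp` -/

/-- The function `(x e^{-x})' = (1 - x) e^{-x}`. -/
noncomputable def profileDeriv (x : ℝ) : ℝ := (1 - x) * Real.exp (-x)

theorem integrable_profileDeriv {k : ℝ} (hk : 1 ≤ k) :
    Integrable profileDeriv (weightMeasure k) := by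
  have h1 : Integrable (fun x => Real.exp (-x)) (weightMeasure k) :=
    memLp_one_iff_integrable.1 (memLp_weight k (c := 1) (R := 0) (by fun_prop) fun x _ => by simp)
  have h0 : ∫ z in Ioi (0 : ℝ), Real.exp (-z) = 1 := integral_exp_neg_Ioi_zero
  -- The function `(x - 1) e^{-x}` solves `y' + y = e^{-x}`, `y(0) = -1`, so its integrability comes
  -- from the kernel bound.
  have h2 : Integrable (fun x => (x - 1) * Real.exp (-x)) (weightMeasure k) := by
    refine integrable_of_ode hk h1 (by fun_prop) (fun x => ?_) (by rw [h0]; simp)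
    have := ((hasDerivAt_id x).sub_const 1).mul ((hasDerivAt_neg x).exp)
    refine this.congr_deriv ?_
    simp only [id]
    ring
  refine h2.neg.congr (Eventually.of_forall fun x => ?_)
  simp only [Pi.neg_apply, profileDeriv]
  ring

/-- Since `∫ A φ = 0`, `A² φ = G₀ ∗ A φ = Q ∗ φ - Q ∫ φ` with `Q = G₀ ∗ G₀`; the remaining term of
the kernel integrates to the first moment times `Q'`. -/
theorem TestFn.kernelFun_convSqKernel (φ : TestFn) {x : ℝ} (hx : 0 < x) :
    kernelFun convSqKernel φ x = kernelFun convKernel (convSol φ) x +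
      firstMoment φ * profileDeriv x := by
  have hφc := φ.continuous
  have hφi : IntegrableOn φ (Ioi 0) := φ.integrable.integrableOn
  have hci := integrableOn_of_weight zero_le_one (φ.integrable_convSol le_rfl)
  have hi2 := integrableOn_id_mul_of_weight le_rfl (φ.integrable_weight 1)
  set P : ℝ → ℝ := fun x => ∫ z in (0 : ℝ)..x, Real.exp z * φ z with hP
  set P1 : ℝ → ℝ := fun x => ∫ z in (0 : ℝ)..x, z * (Real.exp z * φ z) with hP1
  have hc : Continuous fun z => Real.exp z * φ z := Real.continuous_exp.mul hφc
  have hc1 : Continuous fun z => z * (Real.exp z * φ z) := continuous_id.mul hc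
  have hPd : ∀ x, HasDerivAt P (Real.exp x * φ x) x := fun x =>
    intervalIntegral.integral_hasDerivAt_right (hc.intervalIntegrable _ _)
      (hc.stronglyMeasurableAtFilter _ _) hc.continuousAt
  have hP1d : ∀ x, HasDerivAt P1 (x * (Real.exp x * φ x)) x := fun x =>
    intervalIntegral.integral_hasDerivAt_right (hc1.intervalIntegrable _ _)
      (hc1.stronglyMeasurableAtFilter _ _) hc1.continuousAt
  set m := ∫ z in Ioi (0 : ℝ), φ z with hm
  have hL : kernelFun convKernel (convSol φ) x =
      Real.exp (-x) * (x * P x - P1 x - x * m) := by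
    refine kernelFun_convKernel_eq_of_ode (y := fun x => Real.exp (-x) * (x * P x - P1 x - x * m))
      hci (continuous_convSol hφc) (fun x => ?_) ?_ hx
    · have := ((hasDerivAt_neg x).exp).mul ((((hasDerivAt_id x).mul (hPd x)).sub (hP1d x)).sub
        ((hasDerivAt_id x).mul_const m))
      refine this.congr_deriv ?_
      simp only [id, convSol, Pi.sub_apply, Pi.mul_apply]
      ring
    · rw [φ.integral_convSol]
      simp [hP1]
  have hIoo : ∀ {g : ℝ → ℝ}, Continuous g → IntegrableOn ((Ioo 0 x).indicator g) (Ioi 0) :=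
    fun hg => ((integrable_indicator_iff measurableSet_Ioo).2
      (hg.integrableOn_Icc.mono_set Ioo_subset_Icc_self)).integrableOn
  have hInt : ∀ g : ℝ → ℝ, ∫ z in Ioi (0 : ℝ), (Ioo 0 x).indicator g z = ∫ z in (0 : ℝ)..x, g z :=
    fun g => by
      rw [setIntegral_indicator measurableSet_Ioo,
        inter_eq_self_of_subset_right Ioo_subset_Ioi_self,
        intervalIntegral.integral_of_le hx.le, integral_Ioc_eq_integral_Ioo]
  have e : ∀ z ∈ Ioi (0 : ℝ), convSqKernel x z * φ z =
      Real.exp (-x) * ((x * (Ioo 0 x).indicator (fun z => Real.exp z * φ z) z -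
        (Ioo 0 x).indicator (fun z => z * (Real.exp z * φ z)) z) - x * φ z
        + (1 - x) * (z * φ z)) := by
    intro z hz
    have hz0 : (0 : ℝ) < z := hz
    unfold convSqKernel
    by_cases h : z < x
    · have hzm : z ∈ Ioo 0 x := ⟨hz0, h⟩
      rw [if_pos h, indicator_of_mem hzm, indicator_of_mem hzm]; ring
    · have hzm : z ∉ Ioo 0 x := fun hh => h hh.2
      rw [if_neg h, indicator_of_notMem hzm, indicator_of_notMem hzm]; ring
  have i1 : IntegrableOn (fun z => x * (Ioo 0 x).indicator (fun z => Real.exp z * φ z) z)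
      (Ioi 0) := (hIoo hc).const_mul x
  have i2 : IntegrableOn (fun z => x * (Ioo 0 x).indicator (fun z => Real.exp z * φ z) z -
      (Ioo 0 x).indicator (fun z => z * (Real.exp z * φ z)) z) (Ioi 0) := i1.sub (hIoo hc1)
  have i3 : IntegrableOn (fun z => x * (Ioo 0 x).indicator (fun z => Real.exp z * φ z) z -
      (Ioo 0 x).indicator (fun z => z * (Real.exp z * φ z)) z - x * φ z) (Ioi 0) :=
    i2.sub (hφi.const_mul x)
  rw [kernelFun, setIntegral_congr_fun measurableSet_Ioi e, integral_const_mul,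
    integral_add i3 (hi2.const_mul _), integral_sub i2 (hφi.const_mul x),
    integral_sub i1 (hIoo hc1), integral_const_mul, integral_const_mul,
    integral_const_mul, hInt, hInt, hL, profileDeriv, firstMoment]
  ring

/-- The correction is kept as an explicit term so that the estimate holds on the whole space, where
test functions are dense; it drops out when the first moment is zero. -/
theorem norm_convOp_sq_dilation_le {k : ℝ} (hk : 1 ≤ k) (hk2 : 2 ≤ k) (t : ℝ≥0) (h : L1w k) :
    ‖convOp hk (convOp hk (dilation (zero_le_one.trans hk) t h)) +
        firstMoment (dilation (zero_le_one.trans hk) t h) •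
          (integrable_profileDeriv hk).toL1 profileDeriv‖ ≤
      11 * expConst k * Real.exp (-t) ^ 3 * ‖h‖ := by
  set hk0 := zero_le_one.trans hk
  refine (dense_range_testIncl k).induction_on h ?_ fun φ => ?_
  · have hcont : Continuous fun h : L1w k => momentCLM hk (dilation hk0 t h) := by fun_prop
    simp only [momentCLM_apply] at hcont
    exact isClosed_le (by fun_prop) (by fun_prop)
  · have hsi := integrable_of_ode hk ((φ.dil t).integrable_convSol hk)
      (continuous_convSol (φ.dil t).continuous)
      (hasDerivAt_convSol (continuous_convSol (φ.dil t).continuous)) (convSol_zero _)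
    have e : convOp hk (convOp hk (dilation hk0 t (testIncl k φ))) +
        firstMoment (dilation hk0 t (testIncl k φ)) •
          (integrable_profileDeriv hk).toL1 profileDeriv =
        (convSqKernel_bound hk2 ((φ.dil t).integrable_weight k)).1.toL1
          (kernelFun convSqKernel (φ.dil t)) := by
      symm
      rw [dilation_testIncl, convOp_testIncl, convOp_toL1, testIncl_apply, firstMoment_toL1,
        ← Integrable.toL1_smul, ← Integrable.toL1_add, Integrable.toL1_eq_toL1_iff]
      refine ae_weight_iff.2 ?_
      filter_upwards [ae_restrict_mem measurableSet_Ioi] with x hx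
      rw [(φ.dil t).kernelFun_convSqKernel hx]
      rfl
    rw [e, norm_toL1_weight, testIncl_apply, norm_toL1_weight]
    refine (convSqKernel_bound hk2 ((φ.dil t).integrable_weight k)).2.trans ?_
    rw [mul_assoc (11 * expConst k)]
    refine mul_le_mul_of_nonneg_left ?_ (by have := expConst_pos k; positivity)
    have := integral_pow_mul_rpow_dilation_le (j := 2) (by simpa using hk2) (one_le_exp_coe t)
      (φ.integrable_weight k)
    rw [Nat.cast_ofNat, ← Real.exp_neg] at this
    exact this

end Coagulation

namespace Coagulation

/-! ### The linearised coagulation semigroup -/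

/-- The operator `1 + (e^t - 1) convOp`. -/
noncomputable def smoothing {k : ℝ} (hk : 1 ≤ k) (t : ℝ≥0) : L1w k →L[ℝ] L1w k :=
  ContinuousLinearMap.id ℝ (L1w k) + (Real.exp t - 1) • convOp hk

theorem smoothing_apply {k : ℝ} (hk : 1 ≤ k) (t : ℝ≥0) (h : L1w k) :
    smoothing hk t h = h + (Real.exp t - 1) • convOp hk h := rfl

theorem smoothing_zero {k : ℝ} (hk : 1 ≤ k) (h : L1w k) : smoothing hk 0 h = h := by
  simp [smoothing_apply]

theorem smoothing_comm {k : ℝ} (hk : 1 ≤ k) (s t : ℝ≥0) (h : L1w k) :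
    smoothing hk s (smoothing hk t h) = smoothing hk t (smoothing hk s h) := by
  simp only [smoothing_apply, map_add, map_smul]
  module

/-- Multiplied by `e^s`, the intertwining relation reads `R_s D_s A = e^s A D_s`. Hence `R_s D_s R_t
= R_s D_s + (e^t - 1) e^s A D_s`, and the coefficients of `A D_s` add up to `e^{s+t} - 1`. -/
theorem smoothing_dilation {k : ℝ} (hk : 1 ≤ k) (s t : ℝ≥0) (h : L1w k) :
    smoothing hk s (dilation (zero_le_one.trans hk) s (smoothing hk t h)) =
      smoothing hk (s + t) (dilation (zero_le_one.trans hk) s h) := by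
  have h1 := convOp_dilation hk s h
  have h2 : Real.exp s * Real.exp (-s) = 1 := by rw [← Real.exp_add]; simp
  have h3 : Real.exp s • convOp hk (dilation (zero_le_one.trans hk) s h) =
      dilation (zero_le_one.trans hk) s (convOp hk h) + (Real.exp s - 1) •
        convOp hk (dilation (zero_le_one.trans hk) s (convOp hk h)) := by
    rw [h1, smul_add, smul_smul, smul_smul, h2, one_smul, mul_sub, h2, mul_one]
  simp only [smoothing_apply, map_add, map_smul, NNReal.coe_add, Real.exp_add]
  have h4 : (Real.exp s * Real.exp t - 1) •
      convOp hk (dilation (zero_le_one.trans hk) s h) = (Real.exp s - 1) •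
        convOp hk (dilation (zero_le_one.trans hk) s h) + (Real.exp t - 1) •
        (Real.exp s • convOp hk (dilation (zero_le_one.trans hk) s h)) := by
    module
  rw [h4, h3]
  module

/-- The semigroup generated by the linearised coagulation operator. -/
noncomputable def coagSemigroup {k : ℝ} (hk : 1 ≤ k) : C0Semigroup (L1w k) where
  op t := ((smoothing hk t).comp (smoothing hk t)).comp (dilation (zero_le_one.trans hk) t)
  op_zero := by
    ext1 h
    simp only [ContinuousLinearMap.comp_apply, smoothing_zero, dilation_zero]
  op_add s t := by
    ext1 h
    simp only [ContinuousLinearMap.comp_apply]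
    -- `R_s² D_s R_t² D_t = R_s R_{s+t} D_s R_t D_t = R_{s+t} R_s D_s R_t D_t = R_{s+t}² D_s D_t`.
    rw [smoothing_dilation, smoothing_comm hk s (s + t), smoothing_dilation, dilation_add,
      ContinuousLinearMap.comp_apply]
  continuous_orbit u := by
    have hd := continuous_dilation_orbit (zero_le_one.trans hk) u
    simp only [ContinuousLinearMap.comp_apply, smoothing_apply]
    fun_prop

theorem coagSemigroup_apply {k : ℝ} (hk : 1 ≤ k) (t : ℝ≥0) (h : L1w k) :
    (coagSemigroup hk).op t h =
      smoothing hk t (smoothing hk t (dilation (zero_le_one.trans hk) t h)) := rfl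

theorem firstMoment_smoothing {k : ℝ} (hk : 1 ≤ k) (t : ℝ≥0) (h : L1w k) :
    firstMoment (smoothing hk t h) = Real.exp t * firstMoment h := by
  rw [← momentCLM_apply hk, ← momentCLM_apply hk, smoothing_apply, map_add, map_smul,
    momentCLM_apply, momentCLM_apply, firstMoment_convOp, smul_eq_mul]
  ring

theorem firstMoment_coagSemigroup {k : ℝ} (hk : 1 ≤ k) (t : ℝ≥0) (h : L1w k) :
    firstMoment ((coagSemigroup hk).op t h) = firstMoment h := by
  have h2 : Real.exp t * Real.exp (-t) = 1 := by rw [← Real.exp_add]; simp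
  rw [coagSemigroup_apply, firstMoment_smoothing, firstMoment_smoothing, firstMoment_dilation]
  linear_combination (Real.exp t * Real.exp (-t) + 1) * firstMoment h * h2

/-- Each factor `e^t - 1` is compensated by the extra `e^{-t}` gained from one application of
`convOp`; the constants are `1 + 2·5 M + 11 M`. -/
theorem norm_coagSemigroup_le {k : ℝ} (hk : 1 ≤ k) (hk2 : 2 ≤ k) (t : ℝ≥0) {h : L1w k}
    (h0 : firstMoment h = 0) :
    ‖(coagSemigroup hk).op t h‖ ≤ (1 + 21 * expConst k) * Real.exp (-t) * ‖h‖ := by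
  set hk0 := zero_le_one.trans hk
  have b0 := norm_dilation_apply_le hk0 t h
  have b1 := norm_convOp_dilation_le hk t h
  have b2 := norm_convOp_sq_dilation_le hk hk2 t h
  rw [firstMoment_dilation, h0, mul_zero, zero_smul, add_zero] at b2
  have e : (coagSemigroup hk).op t h = dilation hk0 t h +
      (2 * (Real.exp t - 1)) • convOp hk (dilation hk0 t h) +
      ((Real.exp t - 1) ^ 2) • convOp hk (convOp hk (dilation hk0 t h)) := by
    simp only [coagSemigroup_apply, smoothing_apply, map_add, map_smul]
    module
  have h2 : Real.exp t * Real.exp (-t) = 1 := by rw [← Real.exp_add]; simp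
  have h1 := one_le_exp_coe t
  have hM := expConst_pos k
  set E := Real.exp t
  set a := Real.exp (-t) with ha
  have ha0 : 0 < a := Real.exp_pos _
  have c1 : (E - 1) * a ≤ 1 := by nlinarith
  have c1' : 0 ≤ (E - 1) * a := mul_nonneg (by linarith) ha0.le
  have c2 : ((E - 1) * a) ^ 2 ≤ 1 := pow_le_one₀ c1' c1
  rw [e]
  calc _ ≤ ‖dilation hk0 t h‖ + ‖(2 * (E - 1)) • convOp hk (dilation hk0 t h)‖ +
        ‖((E - 1) ^ 2) • convOp hk (convOp hk (dilation hk0 t h))‖ := norm_add₃_le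
    _ = ‖dilation hk0 t h‖ + 2 * (E - 1) * ‖convOp hk (dilation hk0 t h)‖ +
        (E - 1) ^ 2 * ‖convOp hk (convOp hk (dilation hk0 t h))‖ := by
      rw [norm_smul, norm_smul, Real.norm_of_nonneg (by linarith),
        Real.norm_of_nonneg (by positivity)]
    _ ≤ a * ‖h‖ + 2 * (E - 1) * (5 * expConst k * a ^ 2 * ‖h‖) +
        (E - 1) ^ 2 * (11 * expConst k * a ^ 3 * ‖h‖) := by
      have : 0 ≤ E - 1 := by linarith
      gcongr
    _ = a * ‖h‖ + ((E - 1) * a) * (10 * expConst k * a * ‖h‖) +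
        ((E - 1) * a) ^ 2 * (11 * expConst k * a * ‖h‖) := by ring
    _ ≤ a * ‖h‖ + 1 * (10 * expConst k * a * ‖h‖) + 1 * (11 * expConst k * a * ‖h‖) := by
      gcongr
    _ = _ := by ring

/-! ### Identification of the generator -/

theorem tendsto_smoothing_sq {k : ℝ} (hk : 1 ≤ k) :
    Tendsto (fun t : ℝ≥0 => (t : ℝ)⁻¹ •
      ((smoothing hk t).comp (smoothing hk t) - ContinuousLinearMap.id ℝ (L1w k))) (𝓝[>] 0)
      (𝓝 ((2 : ℝ) • convOp hk)) := by
  have h1 : Tendsto (fun t : ℝ≥0 => (t : ℝ)⁻¹ * (Real.exp t - 1)) (𝓝[>] 0) (𝓝 1) := by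
    have h := hasDerivAt_iff_tendsto_slope.1 (Real.hasDerivAt_exp 0)
    have h2 := (h.mono_left (nhdsWithin_mono 0 fun y (hy : 0 < y) => hy.ne')).comp
      tendsto_coe_nhdsGT_zero
    rw [Real.exp_zero] at h2
    refine h2.congr fun t => ?_
    simp [slope_def_module]
  have h2 : Tendsto (fun t : ℝ≥0 => Real.exp t - 1) (𝓝[>] 0) (𝓝 0) := by
    have : Continuous fun t : ℝ≥0 => Real.exp t - 1 := by fun_prop
    have h := this.tendsto 0
    simp only [NNReal.coe_zero, Real.exp_zero, sub_self] at h
    exact h.mono_left nhdsWithin_le_nhds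
  -- With `ε = e^t - 1`, the quotient is `2 (ε/t) A + (ε/t) ε A²`. Only scalars depend on `t`, so
  -- convergence is in operator norm.
  have h3 := ((h1.const_mul 2).smul_const (convOp hk)).add
    ((h1.mul h2).smul_const ((convOp hk).comp (convOp hk)))
  rw [mul_one, mul_zero, zero_smul, add_zero] at h3
  refine h3.congr fun t => ?_
  ext1 h
  simp only [smoothing_apply, ContinuousLinearMap.comp_apply, add_apply, smul_apply, sub_apply,
    ContinuousLinearMap.id_apply, map_add, map_smul]
  module

theorem TestFn.linExpr_eq (φ : TestFn) (x : ℝ) :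
    linExpr φ x = φ.euler x + 2 * convSol φ x := by
  rw [linExpr, halfConv_profile, TestFn.euler_apply, convSol, profile]
  ring

theorem linTest_eq {k : ℝ} (hk : 1 ≤ k) (φ : TestFn) :
    linTest k φ = testIncl k φ.euler + (2 : ℝ) • convOp hk (testIncl k φ) := by
  have e : linTest k φ = (memLp_one_iff_integrable.1 (φ.memLp_linExpr k)).toL1 (linExpr φ) := rfl
  rw [e, convOp_testIncl, testIncl_apply, ← Integrable.toL1_smul, ← Integrable.toL1_add,
    Integrable.toL1_eq_toL1_iff]
  refine ae_weight_iff.2 ?_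
  exact Eventually.of_forall φ.linExpr_eq

theorem graph_L0core (k : ℝ) :
    ((L0core k).graph : Set (L1w k × L1w k)) = range fun φ => (testIncl k φ, linTest k φ) := by
  ext ⟨u, v⟩
  rw [SetLike.mem_coe, LinearPMap.mem_graph_iff]
  have key : ∀ φ, linTest k ((LinearEquiv.ofInjective (testIncl k) (testIncl_injective k)).symm
      ⟨testIncl k φ, LinearMap.mem_range_self _ φ⟩) = linTest k φ := fun φ => by
    congr 1
    rw [LinearEquiv.symm_apply_eq]
    rfl
  constructor
  · rintro ⟨⟨_, φ, rfl⟩, h1, h2⟩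
    refine ⟨φ, Prod.ext h1 ?_⟩
    rw [← h2]
    exact (key φ).symm
  · rintro ⟨φ, h⟩
    rw [Prod.mk.injEq] at h
    exact ⟨⟨testIncl k φ, LinearMap.mem_range_self _ φ⟩, h.1, (key φ).trans h.2⟩

/-- The shear `(u, v) ↦ (u, v + 2 A u)` is a homeomorphism carrying the graph of `x d/dx` on test
functions onto that of the core operator, hence closure onto closure. -/
theorem gen_coagSemigroup_iff {k : ℝ} (hk : 1 ≤ k) (u v : L1w k) :
    (coagSemigroup hk).Gen u v ↔ (u, v) ∈ (L0core k).graph.topologicalClosure := by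
  rw [C0Semigroup.gen_iff_of_factor (S := coagSemigroup hk)
    (T := dilationSemigroup (zero_le_one.trans hk)) (fun t => rfl) (tendsto_smoothing_sq hk),
    gen_dilation_iff, ← SetLike.mem_coe, Submodule.topologicalClosure_coe, graph_L0core]
  have hc1 : Continuous fun p : L1w k × L1w k => (p.1, p.2 + (2 : ℝ) • convOp hk p.1) := by
    fun_prop
  have hc2 : Continuous fun p : L1w k × L1w k => (p.1, p.2 - (2 : ℝ) • convOp hk p.1) := by
    fun_prop
  constructor
  · intro h
    have := map_mem_closure (t := range fun φ => (testIncl k φ, linTest k φ)) hc1 h (by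
      rintro _ ⟨φ, rfl⟩
      exact ⟨φ, by simp only [linTest_eq hk]⟩)
    simpa using this
  · intro h
    have := map_mem_closure
      (t := range fun φ : TestFn => (testIncl k φ, testIncl k φ.euler)) hc2 h (by
        rintro _ ⟨φ, rfl⟩
        exact ⟨φ, by simp only [linTest_eq hk, add_sub_cancel_right]⟩)
    exact this

/-- The closed graph is that of a generator, and limits are unique, so it contains no `(0, v)` with
`v ≠ 0`. -/
theorem isClosable_L0core {k : ℝ} (hk : 1 ≤ k) : (L0core k).IsClosable := by
  refine ⟨(L0core k).graph.topologicalClosure.toLinearPMap, ?_⟩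
  rw [Submodule.toLinearPMap_graph_eq]
  rintro ⟨u, v⟩ h hu
  have h1 := (gen_coagSemigroup_iff hk u v).2 h
  have h2 : (coagSemigroup hk).Gen 0 0 := by
    simp [C0Semigroup.Gen]
  have hu' : u = 0 := hu
  rw [hu'] at h1
  exact h1.unique h2

theorem isGenerator_L0 {k : ℝ} (hk : 1 ≤ k) : IsGenerator (L0 k) (coagSemigroup hk) := by
  intro u v
  rw [L0, ← (isClosable_L0core hk).graph_closure_eq_closure_graph]
  exact (gen_coagSemigroup_iff hk u v).symm

/-- The semigroup conserves the first moment, so all difference quotients have moment zero. This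
makes the decay estimate available for the image of the generator. -/
theorem firstMoment_eq_zero_of_gen {k : ℝ} (hk : 1 ≤ k) {u v : L1w k}
    (h : (coagSemigroup hk).Gen u v) : firstMoment v = 0 := by
  have h1 := ((momentCLM hk).continuous.tendsto v).comp h
  refine tendsto_nhds_unique h1 (tendsto_const_nhds.congr fun t => ?_)
  rw [Function.comp_apply, map_smul, map_sub, momentCLM_apply, momentCLM_apply,
    firstMoment_coagSemigroup, sub_self, smul_zero]

end Coagulation

theorem theorem6p2 (k : ℝ) (hk : 2 < k) :
    (Coagulation.L0core k).IsClosable ∧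
    ∃ T : Coagulation.C0Semigroup (Coagulation.L1w k),
      Coagulation.IsGenerator (Coagulation.L0 k) T ∧
      (∀ (t : ℝ≥0) (h : Coagulation.L1w k),
        Coagulation.firstMoment h = 0 → Coagulation.firstMoment (T.op t h) = 0) ∧
      ∃ C : ℝ, 0 < C ∧
        (∀ (t : ℝ≥0) (h : Coagulation.L1w k), Coagulation.firstMoment h = 0 →
          ‖T.op t h‖ ≤ C * Real.exp (-(1 / 2) * (t : ℝ)) * ‖h‖) ∧
        (∀ h : (Coagulation.L0 k).domain, Coagulation.firstMoment (h : Coagulation.L1w k) = 0 →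
          1 / (2 * C) * ‖(h : Coagulation.L1w k)‖ ≤ ‖Coagulation.L0 k h‖) := by
  have hk1 : 1 ≤ k := by linarith
  have hM := Coagulation.expConst_pos k
  have hdecay : ∀ (t : ℝ≥0) (h : Coagulation.L1w k), Coagulation.firstMoment h = 0 →
      ‖(Coagulation.coagSemigroup hk1).op t h‖ ≤
        (1 + 21 * Coagulation.expConst k) * Real.exp (-(1 / 2) * (t : ℝ)) * ‖h‖ := by
    intro t h h0
    -- The rate `e^{-t}` is relaxed to `e^{-t/2}`, so that dividing by `1/2` below gives exactly `M
    -- = 2C`.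
    refine (Coagulation.norm_coagSemigroup_le hk1 hk.le t h0).trans ?_
    gcongr
    have : (0 : ℝ) ≤ t := t.2
    linarith
  refine ⟨Coagulation.isClosable_L0core hk1, Coagulation.coagSemigroup hk1,
    Coagulation.isGenerator_L0 hk1, fun t h h0 => ?_, 1 + 21 * Coagulation.expConst k,
    by positivity, hdecay, fun h h0 => ?_⟩
  · rw [Coagulation.firstMoment_coagSemigroup, h0]
  · have hg : (Coagulation.coagSemigroup hk1).Gen (h : Coagulation.L1w k)
        (Coagulation.L0 k h) :=
      (Coagulation.isGenerator_L0 hk1 _ _).1 ((Coagulation.L0 k).mem_graph h)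
    have h1 := hg.norm_le (by norm_num : (0 : ℝ) < 1 / 2) (fun t => hdecay t _ h0)
      (fun t => hdecay t _ (Coagulation.firstMoment_eq_zero_of_gen hk1 hg))
    rw [one_div, inv_mul_le_iff₀ (by positivity)]
    linarith
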